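/- Let $n\ge 1$ and let $H,B$ be real $n\times n$ matrices such that $B$ is symmetric positive semidefinite, $H$ has $n$ distinct (simple) eigenvalues $-\mu_1,\dots,-\mu_n\in\mathbb C$ with $\operatorname{Re}\mu_k>0$, and $(H,B)$ is a controllable pair: the only vector $z$ with $z^TH^kB=0$ for $k=0,\dots,n-1$ is $z=0$. Let $$\mathcal D\varphi=\tfrac12\operatorname{div}(B\nabla\varphi)-\operatorname{div}(Hs\,\varphi),\qquad \varphi:\mathbb R^n\to\mathbb C,$$ be the Fokker–Planck operator of the vector Ornstein–Uhlenbeck process $\dot s=Hs+\xi$, where $\xi$ is white noise with covariance matrix $B$. An eigenfunction of $\mathcal D$ with eigenvalue $\chi$ is a non-zero $C^2$ function $\varphi$ with moments of all orders (that is, $|s|^m\varphi\in L^1(\mathbb R^n)$ for all $m\ge 0$) such that $\mathcal D\varphi=\chi\varphi$. Define the $(2n+1)\times(2n+1)$ matrices $$A=\begin{pmatrix}0&I&0\\-I&0&0\\0&0&0\end{pmatrix},\qquad D=\begin{pmatrix}B&-H&0\\-H^T&0&0\\0&0&-\operatorname{tr}H\end{pmatrix},\qquad T=DA,$$ and for $k=1,\dots,n$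 let $y^{k}$ and $y^{-k}$ be eigenvectors of $T$ with eigenvalues $\mu_k$ and $-\mu_k$. For $y=(p,q,r)\in\mathbb C^n\times\mathbb C^n\times\mathbb C$ write $\mathcal L_y=\sum_j p_j\partial_{s_j}+\sum_j q_js_j+r$, and let $\mathcal L_{\pm k}=\mathcal L_{y^{\pm k}}$ (the ladder operators, satisfying $[\mathcal D,\mathcal L_{\pm k}]=\pm\mu_k\mathcal L_{\pm k}$). With $y^k=(p_k,q_k,r_k)$ put $P=[p_1,\dots,p_n]$, $Q=[q_1,\dots,q_n]$. Then $P$ is invertible, and with $\Sigma=QP^{-1}$, $\Phi_0(s)=\exp(-\frac12\langle s,\Sigma s\rangle)$ and, for $\mathbf k=(k_1,\dots,k_n)\in\mathbb Z_{\ge0}^n$, $$\chi_{\mathbf k}=-\sum_{j=1}^n k_j\mu_j,\qquad \Phi_{\mathbf k}=\mathcal L_{-1}^{k_1}\mathcal L_{-2}^{k_2}\cdots\mathcal L_{-n}^{k_n}\Phi_0,$$ the following hold. 1. A number $\chi\in\mathbb C$ is an eigenvalue of $\mathcal D$ if and only if $\chi=\chi_{\mathbf k}$ for some $\mathbf k\in\mathbb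 Z_{\ge0}^n$. 2. For every $\mathbf k$, $\Phi_{\mathbf k}$ is an eigenfunction of $\mathcal D$ with eigenvalue $\chi_{\mathbf k}$. 3. Every eigenfunction with eigenvalue $\chi$ is a finite linear combination of the functions $\Phi_{\mathbf k}$ with $\chi_{\mathbf k}=\chi$. The same holds, up to equality almost everywhere, for every function with moments of all orders that satisfies $\mathcal D\varphi=\chi\varphi$ only in the sense of distributions. -/

import Mathlib

open MeasureTheory
open scoped ContDiff Matrix

namespace OrnsteinUhlenbeck

noncomputable section

/-- The state space `ℝⁿ` with its Euclidean norm and Lebesgue measure. -/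
abbrev Space (n : ℕ) : Type := EuclideanSpace ℝ (Fin n)

/-- The partial derivative `∂φ/∂s_j` of a complex-valued function on `ℝⁿ`. -/
def partialD {n : ℕ} (j : Fin n) (φ : Space n → ℂ) : Space n → ℂ :=
  fun s => fderiv ℝ φ s (EuclideanSpace.single j 1)

/-- The divergence of a vector field on `ℝⁿ` with complex components. -/
def divergence {n : ℕ} (F : Fin n → Space n → ℂ) : Space n → ℂ :=
  fun s => ∑ i, partialD i (F i) s

/-- The Fokker–Planck operator `𝒟 φ = ½ div (B ∇φ) - div (H s φ)`. -/
def fokkerPlanck {n : ℕ} (B H : Matrix (Fin n) (Fin n) ℝ) (φ : Space n → ℂ) : Space n → ℂ :=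
  fun s =>
    (1 / 2 : ℂ) * divergence (fun i t => ∑ j, (B i j : ℂ) * partialD j φ t) s
      - divergence (fun i t => (∑ j, (H i j : ℂ) * (t j : ℂ)) * φ t) s

/-- The formal adjoint of the Fokker–Planck operator (for symmetric `B`),
`𝒟' ψ = ½ div (B ∇ψ) + ⟨H s, ∇ψ⟩`. -/
def fokkerPlanckAdjoint {n : ℕ} (B H : Matrix (Fin n) (Fin n) ℝ) (ψ : Space n → ℂ) :
    Space n → ℂ :=
  fun s =>
    (1 / 2 : ℂ) * divergence (fun i t => ∑ j, (B i j : ℂ) * partialD j ψ t) s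
      + ∑ i, (∑ j, (H i j : ℂ) * (s j : ℂ)) * partialD i ψ s

/-- `φ` has (absolutely convergent) moments of all orders. -/
def HasAllMoments {n : ℕ} (φ : Space n → ℂ) : Prop :=
  ∀ m : ℕ, Integrable (fun s : Space n => ((‖s‖ ^ m : ℝ) : ℂ) * φ s) volume

/-- `φ` is an eigenfunction of the Fokker–Planck operator with eigenvalue `χ`: a non-zero `C²`
function that has moments of all orders and satisfies `𝒟 φ = χ φ` at every point. -/
structure IsEigenfunction {n : ℕ} (B H : Matrix (Fin n) (Fin n) ℝ) (χ : ℂ)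
    (φ : Space n → ℂ) : Prop where
  contDiff : ContDiff ℝ 2 φ
  moments : HasAllMoments φ
  ne_zero : φ ≠ 0
  eigen : ∀ s, fokkerPlanck B H φ s = χ * φ s

/-- `χ` is an eigenvalue of the Fokker–Planck operator on functions with moments of all orders. -/
def IsEigenvalue {n : ℕ} (B H : Matrix (Fin n) (Fin n) ℝ) (χ : ℂ) : Prop :=
  ∃ φ : Space n → ℂ, IsEigenfunction B H χ φ

/-- `φ`, with moments of all orders but without any assumed regularity, satisfies `𝒟 φ = χ φ` in
the sense of distributions. -/
structure IsWeakSolution {n : ℕ} (B H : Matrix (Fin n) (Fin n) ℝ) (χ : ℂ)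
    (φ : Space n → ℂ) : Prop where
  moments : HasAllMoments φ
  eigen : ∀ ψ : Space n → ℂ, ContDiff ℝ ∞ ψ → HasCompactSupport ψ →
    ∫ s, φ s * fokkerPlanckAdjoint B H ψ s = χ * ∫ s, φ s * ψ s

/-- `(H, B)` is a controllable pair: no non-zero vector `z` has `zᵀ Hᵏ B = 0` for all
`k = 0, …, n - 1`. -/
def Controllable {n : ℕ} (H B : Matrix (Fin n) (Fin n) ℝ) : Prop :=
  ∀ z : Fin n → ℝ, (∀ k < n, z ᵥ* (H ^ k * B) = 0) → z = 0

/-- The basic conditions on the real `n × n` matrices `H`, `B`, with `-μ₁, …, -μₙ` an enumeration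
of the eigenvalues of `H`. As `H` is `n × n`, having the `n` distinct eigenvalues `-μ_k` says that
these are all its eigenvalues and that they are simple. -/
structure BasicConditions {n : ℕ} (H B : Matrix (Fin n) (Fin n) ℝ) (μ : Fin n → ℂ) : Prop where
  posSemidef : B.PosSemidef
  hasEigenvalue : ∀ k,
    Module.End.HasEigenvalue (Matrix.toLin' (H.map (fun x : ℝ => (x : ℂ)))) (-μ k)
  injective : Function.Injective μ
  re_pos : ∀ k, 0 < (μ k).re
  controllable : Controllable H B

/-- The index set of the `2n + 1` operators `∂/∂s_j`, `s_j`, `1`. -/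
abbrev Idx (n : ℕ) : Type := (Fin n ⊕ Fin n) ⊕ Unit

/-- The `2n + 1` operators `L`: the derivatives `∂/∂s_j`, the multiplications by `s_j`, and the
identity. -/
def basicOp {n : ℕ} : Idx n → (Space n → ℂ) → (Space n → ℂ)
  | Sum.inl (Sum.inl j), φ => partialD j φ
  | Sum.inl (Sum.inr j), φ => fun s => (s j : ℂ) * φ s
  | Sum.inr _, φ => φ

/-- The antisymmetric matrix of commutators of the operators `L`. -/
def matA (n : ℕ) : Matrix (Idx n) (Idx n) ℝ :=
  Matrix.fromBlocks (Matrix.fromBlocks 0 1 (-1) 0) 0 0 0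

/-- The symmetric matrix of the coefficients of the Fokker–Planck operator as a quadratic form
`½ ∑ d_{ij} L_i L_j`. -/
def matD {n : ℕ} (B H : Matrix (Fin n) (Fin n) ℝ) : Matrix (Idx n) (Idx n) ℝ :=
  Matrix.fromBlocks (Matrix.fromBlocks B (-H) (-Hᵀ) 0) 0 0 (Matrix.of fun _ _ => -H.trace)

/-- The matrix `T = D A`, as a complex matrix. -/
def matT {n : ℕ} (B H : Matrix (Fin n) (Fin n) ℝ) : Matrix (Idx n) (Idx n) ℂ :=
  (matD B H * matA n).map (fun x : ℝ => (x : ℂ))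

/-- `y` is an eigenvector of `T` with eigenvalue `ν`, i.e. the coefficient vector of a ladder
operator with increment `ν`. -/
def IsLadderVector {n : ℕ} (B H : Matrix (Fin n) (Fin n) ℝ) (ν : ℂ) (y : Idx n → ℂ) : Prop :=
  matT B H *ᵥ y = ν • y ∧ y ≠ 0

/-- The operator `𝓛 = ∑_j y_j L_j`. -/
def ladderOp {n : ℕ} (y : Idx n → ℂ) (φ : Space n → ℂ) : Space n → ℂ :=
  fun s => ∑ j, y j * basicOp j φ s

/-- The matrix `P = [p₁, …, pₙ]` for `y^k = (p_k, q_k, r_k)`. -/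
def matP {n : ℕ} (y : Fin n → Idx n → ℂ) : Matrix (Fin n) (Fin n) ℂ :=
  Matrix.of fun i k => y k (Sum.inl (Sum.inl i))

/-- The matrix `Q = [q₁, …, qₙ]` for `y^k = (p_k, q_k, r_k)`. -/
def matQ {n : ℕ} (y : Fin n → Idx n → ℂ) : Matrix (Fin n) (Fin n) ℂ :=
  Matrix.of fun i k => y k (Sum.inl (Sum.inr i))

/-- The matrix `Σ = Q P⁻¹`. -/
def matSigma {n : ℕ} (y : Fin n → Idx n → ℂ) : Matrix (Fin n) (Fin n) ℂ :=
  matQ y * (matP y)⁻¹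

/-- The function `Φ₀(s) = exp (-½ ⟨s, Σ s⟩)`. -/
def Phi0 {n : ℕ} (y : Fin n → Idx n → ℂ) : Space n → ℂ :=
  fun s => Complex.exp (-(1 / 2 : ℂ) * ∑ i, ∑ j, (s i : ℂ) * matSigma y i j * (s j : ℂ))

/-- `Φ_k = 𝓛₋₁^{k₁} 𝓛₋₂^{k₂} ⋯ 𝓛₋ₙ^{kₙ} Φ₀`, where `yp j` and `ym j` are the coefficient vectors of
`𝓛_j` and `𝓛_{-j}`. -/
def PhiK {n : ℕ} (yp ym : Fin n → Idx n → ℂ) (k : Fin n → ℕ) : Space n → ℂ :=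
  (List.finRange n).foldr (fun j f => (ladderOp (ym j))^[k j] f) (Phi0 yp)

/-- `χ_k = -∑_j k_j μ_j`. -/
def chiK {n : ℕ} (μ : Fin n → ℂ) (k : Fin n → ℕ) : ℂ :=
  -∑ j, (k j : ℂ) * μ j

end

end OrnsteinUhlenbeck

open OrnsteinUhlenbeck

namespace OrnsteinUhlenbeck

noncomputable section

/-! The matrix `T` is block triangular with diagonal blocks `H`, `-Hᵀ`, `0`. As `H` is stable, a
ladder vector for `-μ_k` has `q = 0` and `r = 0`, and its `p` is an eigenvector of `H`: the lowering
operators are the directional derivatives along an eigenbasis `v_k` of `H`. For `+μ_k` the vectors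
`q_k` are a basis of eigenvectors of `Hᵀ`, so `Q` is invertible, and the eigenvector equations say
that `Γ = P Q⁻¹` solves the Lyapunov equation `H Γ + Γ Hᵀ = -B`. Uniqueness for that equation makes
`Γ` real and symmetric; stability and controllability make it positive definite. Hence `Σ = Γ⁻¹`,
and `Φ₀` is the stationary Gaussian up to a constant (`BasicConditions.ladder_structure`).

That each `Φ_k` solves the eigenvalue equation follows from the commutation relation
`fokkerPlanck_dirD`, and its moments are finite because it is a polynomial times a Gaussian.

Completeness is proved on the Fourier side. Moments of all orders make `φ̂` smooth, and `𝒟 φ = χ φ`,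
even in the weak sense, becomes the first-order equation `⟨Hᵀξ, ∇φ̂⟩ = (χ + 2π²⟨ξ, Bξ⟩) φ̂`. By the
Lyapunov equation, the factor `exp (2π²⟨ξ, Γξ⟩)` removes the quadratic term, which leaves `⟨Hᵀξ, ∇u⟩
= χ u` for a smooth `u`. Since the flow of `Hᵀ` contracts everything to the origin, such a `u`
vanishes if `Re χ > 0` and is constant if `χ = 0`. Differentiation along an eigenvector of `Hᵀ`
replaces `χ` by `χ + μ_j`, so finitely many derivatives reach these cases, and `u` is a combination
of monomials in the coordinates `⟨v_j, ξ⟩` with `χ_k = χ` (`DualEigenbasis.mem_span_coordMonomial`).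
The same factor turns the transform of `Φ_k` into a non-zero multiple of the monomial with exponents
`k`, so injectivity of the Fourier transform finishes the proof (`exists_mem_span_ae_eq`). -/

/-- The complexification of a real matrix. -/
abbrev complexify {n : ℕ} (M : Matrix (Fin n) (Fin n) ℝ) : Matrix (Fin n) (Fin n) ℂ :=
  M.map (fun x : ℝ => (x : ℂ))

lemma complexify_conjTranspose {n : ℕ} (M : Matrix (Fin n) (Fin n) ℝ) :
    (complexify M)ᴴ = (complexify M)ᵀ := by
  ext i j; simp [complexify]

lemma complexify_mul {n : ℕ} (M N : Matrix (Fin n) (Fin n) ℝ) :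
    complexify (M * N) = complexify M * complexify N := by
  ext i j; simp [Matrix.mul_apply]

lemma complexify_one {n : ℕ} : complexify (1 : Matrix (Fin n) (Fin n) ℝ) = 1 := by
  ext i j
  by_cases h : i = j
  · subst h; simp
  · simp [Matrix.one_apply_ne h]

/-! ### Block structure of `T` and the components of ladder vectors. -/

section Ladder

variable {n : ℕ} {B H : Matrix (Fin n) (Fin n) ℝ} {ν : ℂ} {y : Idx n → ℂ}

/-- The component `p` of `y = (p, q, r)`. -/
def pPart (y : Idx n → ℂ) : Fin n → ℂ := fun i => y (Sum.inl (Sum.inl i))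

/-- The component `q` of `y = (p, q, r)`. -/
def qPart (y : Idx n → ℂ) : Fin n → ℂ := fun i => y (Sum.inl (Sum.inr i))

/-- The triangular form decouples `q` and `r` from the rest of the eigenvector equation; only the
equation for `p` mixes `p` and `q`, through `B`. -/
lemma matT_eq_fromBlocks (B H : Matrix (Fin n) (Fin n) ℝ) :
    matT B H = Matrix.fromBlocks
      (Matrix.fromBlocks (complexify H) (complexify B) 0 (-(complexify H)ᵀ)) 0 0 0 := by
  have : matD B H * matA n = Matrix.fromBlocks (Matrix.fromBlocks H B 0 (-Hᵀ)) 0 0 0 := by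
    simp [matD, matA, Matrix.fromBlocks_multiply]
  rw [matT, this]
  ext i j
  rcases i with (i | i) | i <;> rcases j with (j | j) | j <;> simp [Matrix.fromBlocks, complexify]

lemma IsLadderVector.p_eq (h : IsLadderVector B H ν y) :
    complexify H *ᵥ pPart y + complexify B *ᵥ qPart y = ν • pPart y := by
  have h1 := h.1
  rw [matT_eq_fromBlocks] at h1
  ext i
  have h2 := congrFun h1 (Sum.inl (Sum.inl i))
  simpa [Matrix.mulVec, dotProduct, Matrix.fromBlocks, Fintype.sum_sum_type, pPart, qPart] using h2

lemma IsLadderVector.q_eq (h : IsLadderVector B H ν y) :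
    (complexify H)ᵀ *ᵥ qPart y = (-ν) • qPart y := by
  have h1 := h.1
  rw [matT_eq_fromBlocks] at h1
  ext i
  have h2 := congrFun h1 (Sum.inl (Sum.inr i))
  simp [Matrix.mulVec, dotProduct, Matrix.fromBlocks, Fintype.sum_sum_type] at h2
  simp [Matrix.mulVec, dotProduct, qPart, ← h2]

lemma IsLadderVector.r_eq (h : IsLadderVector B H ν y) (hν : ν ≠ 0) (u : Unit) :
    y (Sum.inr u) = 0 := by
  have h1 := h.1
  rw [matT_eq_fromBlocks] at h1
  have h2 := congrFun h1 (Sum.inr u)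
  simpa [Matrix.mulVec, dotProduct, Matrix.fromBlocks, Fintype.sum_sum_type, hν] using h2

lemma IsLadderVector.ne_zero (h : IsLadderVector B H ν y) (hν : ν ≠ 0)
    (hq : qPart y = 0) : pPart y ≠ 0 := by
  intro hp
  apply h.2
  ext i
  rcases i with (i | i) | i
  · exact congrFun hp i
  · exact congrFun hq i
  · exact h.r_eq hν i

end Ladder

/-! ### Eigenbases, the Lyapunov equation and the stationary covariance. -/

/-- Eigenvectors of a square matrix with distinct eigenvalues form an invertible matrix. -/
lemma isUnit_det_of_eigenvectors {n : ℕ} {M : Matrix (Fin n) (Fin n) ℂ} {lam : Fin n → ℂ}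
    (hlam : Function.Injective lam) {v : Fin n → Fin n → ℂ} (hv : ∀ k, M *ᵥ v k = lam k • v k)
    (hv0 : ∀ k, v k ≠ 0) : IsUnit (Matrix.of fun i k => v k i).det := by
  have hli : LinearIndependent ℂ v := by
    apply Module.End.eigenvectors_linearIndependent' (Matrix.toLin' M) lam hlam v
    intro k
    rw [Module.End.hasEigenvector_iff, Module.End.mem_eigenspace_iff]
    exact ⟨by simpa using hv k, hv0 k⟩
  have h2 : IsUnit (Matrix.of fun k i => v k i) := by
    rw [← Matrix.linearIndependent_rows_iff_isUnit]
    exact hli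
  rw [Matrix.isUnit_iff_isUnit_det, ← Matrix.det_transpose] at h2
  exact h2

/-- A transposed matrix has no eigenvalues but those of the matrix. -/
lemma eigenvalue_transpose_mem {n : ℕ} {M : Matrix (Fin n) (Fin n) ℂ} {lam : Fin n → ℂ}
    {v : Fin n → Fin n → ℂ} (hv : ∀ k, M *ᵥ v k = lam k • v k)
    (hdet : IsUnit (Matrix.of fun i k => v k i).det) {q : Fin n → ℂ} {ν : ℂ} (hq0 : q ≠ 0)
    (hq : Mᵀ *ᵥ q = ν • q) : ∃ k, ν = lam k := by
  by_contra! hne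
  apply hq0
  -- Evaluating `q ⬝ᵥ M *ᵥ v k` in two ways makes `q` orthogonal to every `v k`, as the eigenvalues
  -- differ; the `v k` form a basis.
  have h1 : q ᵥ* (Matrix.of fun i k => v k i) = 0 := by
    ext k
    have e1 : q ⬝ᵥ (M *ᵥ v k) = lam k * (q ⬝ᵥ v k) := by rw [hv k]; simp
    have e2 : q ⬝ᵥ (M *ᵥ v k) = ν * (q ⬝ᵥ v k) := by
      rw [Matrix.dotProduct_mulVec, ← Matrix.mulVec_transpose, hq]; simp
    have e3 : (ν - lam k) * (q ⬝ᵥ v k) = 0 := by linear_combination e1 - e2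
    have := (mul_eq_zero.1 e3).resolve_left (sub_ne_zero.2 (hne k))
    simpa [Matrix.vecMul, dotProduct] using this
  have h2 := congrArg (fun z => z ᵥ* (Matrix.of fun i k => v k i)⁻¹) h1
  simpa [Matrix.vecMul_vecMul, Matrix.mul_nonsing_inv _ hdet] using h2

/-- Uniqueness of the solution of the Lyapunov equation. -/
lemma lyapunov_unique {n : ℕ} {M : Matrix (Fin n) (Fin n) ℂ} {μ : Fin n → ℂ}
    (hμ : ∀ k, 0 < (μ k).re) {v : Fin n → Fin n → ℂ} (hv : ∀ k, M *ᵥ v k = (-μ k) • v k)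
    (hdet : IsUnit (Matrix.of fun i k => v k i).det) {X : Matrix (Fin n) (Fin n) ℂ}
    (hX : M * X + X * Mᵀ = 0) : X = 0 := by
  set V : Matrix (Fin n) (Fin n) ℂ := Matrix.of fun i k => v k i with hV
  have hMV : M * V = V * Matrix.diagonal (fun k => -μ k) := by
    ext i k
    have := congrFun (hv k) i
    simp only [Matrix.mul_diagonal]
    simpa [Matrix.mul_apply, Matrix.mulVec, dotProduct, hV, mul_comm] using this
  have h1 : V⁻¹ * M = Matrix.diagonal (fun k => -μ k) * V⁻¹ := by
    have : V⁻¹ * (M * V) * V⁻¹ = V⁻¹ * (V * Matrix.diagonal (fun k => -μ k)) * V⁻¹ := by rw [hMV]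
    rwa [← Matrix.mul_assoc V⁻¹ V, Matrix.nonsing_inv_mul _ hdet, Matrix.one_mul, Matrix.mul_assoc,
      Matrix.mul_assoc, Matrix.mul_nonsing_inv _ hdet, Matrix.mul_one] at this
  have h2 : Mᵀ * V⁻¹ᵀ = V⁻¹ᵀ * Matrix.diagonal (fun k => -μ k) := by
    have := congrArg Matrix.transpose h1
    simpa [Matrix.transpose_mul] using this
  -- In eigencoordinates the equation multiplies the entry `(i, j)` by `-(μ i + μ j)`, which is
  -- non-zero because its real part is negative.
  have hY : V⁻¹ * X * V⁻¹ᵀ = 0 := by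
    ext i j
    have e : V⁻¹ * (M * X + X * Mᵀ) * V⁻¹ᵀ = 0 := by rw [hX]; simp
    have e2 : V⁻¹ * (M * X + X * Mᵀ) * V⁻¹ᵀ =
        Matrix.diagonal (fun k => -μ k) * (V⁻¹ * X * V⁻¹ᵀ) +
        (V⁻¹ * X * V⁻¹ᵀ) * Matrix.diagonal (fun k => -μ k) := by
      rw [Matrix.mul_add, Matrix.add_mul, ← Matrix.mul_assoc, h1]
      simp only [Matrix.mul_assoc, h2]
    rw [e2] at e
    have e3 := congrFun (congrFun e i) j
    rw [Matrix.add_apply, Matrix.diagonal_mul, Matrix.mul_diagonal, Matrix.zero_apply] at e3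
    have e4 : (μ i + μ j) * (V⁻¹ * X * V⁻¹ᵀ) i j = 0 := by linear_combination -e3
    refine (mul_eq_zero.1 e4).resolve_left ?_
    intro h0
    have := congrArg Complex.re h0
    have hi := hμ i
    have hj := hμ j
    simp at this
    linarith
  have hT : V⁻¹ᵀ * Vᵀ = 1 := by
    rw [← Matrix.transpose_mul, Matrix.mul_nonsing_inv _ hdet, Matrix.transpose_one]
  calc X = V * (V⁻¹ * X * V⁻¹ᵀ) * Vᵀ := by
        rw [Matrix.mul_assoc, Matrix.mul_assoc, hT, Matrix.mul_one, ← Matrix.mul_assoc,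
          Matrix.mul_nonsing_inv _ hdet, Matrix.one_mul]
    _ = 0 := by rw [hY]; simp

/-- A pair of dual bases of eigenvectors: `v` of `H` and `w` of `Hᵀ`. -/
structure DualEigenbasis {n : ℕ} (H : Matrix (Fin n) (Fin n) ℝ) (μ : Fin n → ℂ)
    (v w : Fin n → Fin n → ℂ) : Prop where
  eigen_v : ∀ k, complexify H *ᵥ v k = (-μ k) • v k
  eigen_w : ∀ k, (complexify H)ᵀ *ᵥ w k = (-μ k) • w k
  dual : ∀ j k, w j ⬝ᵥ v k = if j = k then 1 else 0
  resolution : ∀ i i', ∑ j, v j i * w j i' = if i = i' then 1 else 0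

/-- With `V` the matrix of columns `v k`, the dual vectors are the rows of `V⁻¹`: `V⁻¹ V = 1` is
duality and `V V⁻¹ = 1` is the resolution of the identity. -/
lemma exists_dualEigenbasis {n : ℕ} {H : Matrix (Fin n) (Fin n) ℝ} {μ : Fin n → ℂ}
    {v : Fin n → Fin n → ℂ} (hv : ∀ k, complexify H *ᵥ v k = (-μ k) • v k)
    (hdet : IsUnit (Matrix.of fun i k => v k i).det) : ∃ w, DualEigenbasis H μ v w := by
  set V : Matrix (Fin n) (Fin n) ℂ := Matrix.of fun i k => v k i with hV
  have hVW := Matrix.mul_nonsing_inv _ hdet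
  have hWV := Matrix.nonsing_inv_mul _ hdet
  have hMV : complexify H * V = V * Matrix.diagonal (fun k => -μ k) := by
    ext i k
    have := congrFun (hv k) i
    simp only [Matrix.mul_diagonal]
    simpa [Matrix.mul_apply, Matrix.mulVec, dotProduct, hV, mul_comm] using this
  have h1 : V⁻¹ * complexify H = Matrix.diagonal (fun k => -μ k) * V⁻¹ := by
    have : V⁻¹ * (complexify H * V) * V⁻¹ =
      V⁻¹ * (V * Matrix.diagonal (fun k => -μ k)) * V⁻¹ := by rw [hMV]
    rwa [← Matrix.mul_assoc V⁻¹ V, Matrix.nonsing_inv_mul _ hdet, Matrix.one_mul, Matrix.mul_assoc,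
      Matrix.mul_assoc, Matrix.mul_nonsing_inv _ hdet, Matrix.mul_one] at this
  refine ⟨fun k i => V⁻¹ k i, hv, fun k => ?_, fun j k => ?_, fun i i' => ?_⟩
  · ext i
    have := congrFun (congrFun h1 k) i
    rw [Matrix.diagonal_mul] at this
    simpa [Matrix.mul_apply, Matrix.mulVec, dotProduct, mul_comm] using this
  · have := congrFun (congrFun hWV j) k
    simpa [Matrix.mul_apply, dotProduct, hV, Matrix.one_apply] using this
  · have := congrFun (congrFun hVW i) i'
    simpa [Matrix.mul_apply, hV, Matrix.one_apply] using this

/-- For a matrix `H` with eigenvalues in the left half plane, every vector lies on a solution of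
`x' = Hᵀ x` that tends to zero. -/
lemma DualEigenbasis.exists_flow {n : ℕ} {H : Matrix (Fin n) (Fin n) ℝ} {μ : Fin n → ℂ}
    {v w : Fin n → Fin n → ℂ} (h : DualEigenbasis H μ v w) (hμ : ∀ k, 0 < (μ k).re)
    (x : Fin n → ℝ) :
    ∃ X : ℝ → Fin n → ℝ, X 0 = x ∧ (∀ t, HasDerivAt X (Hᵀ *ᵥ X t) t) ∧
      Filter.Tendsto X Filter.atTop (nhds 0) := by
  -- This is `exp (t Hᵀ) x`, expanded in the eigenbasis `w` of `Hᵀ` with coefficients `⟨v k, x⟩`.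
  set Z : ℝ → Fin n → ℂ := fun t i =>
    ∑ k, (∑ i', v k i' * (x i' : ℂ)) * Complex.exp (-μ k * (t : ℂ)) * w k i with hZ
  have hZd : ∀ t i, HasDerivAt (fun t => Z t i) (((complexify H)ᵀ *ᵥ Z t) i) t := by
    intro t i
    have e : ((complexify H)ᵀ *ᵥ Z t) i = ∑ k, (∑ i', v k i' * (x i' : ℂ)) *
        (Complex.exp (-μ k * (t : ℂ)) * (-μ k * 1)) * w k i := by
      have e1 : Z t = ∑ k, ((∑ i', v k i' * (x i' : ℂ)) * Complex.exp (-μ k * (t : ℂ))) • w k := by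
        ext i; simp [hZ]
      rw [e1, Matrix.mulVec_sum]
      simp only [Matrix.mulVec_smul, h.eigen_w]
      simp only [Finset.sum_apply, Pi.smul_apply, smul_eq_mul]
      exact Finset.sum_congr rfl fun k _ => by ring
    rw [e]
    refine HasDerivAt.fun_sum fun k _ => ?_
    have : HasDerivAt (fun t : ℝ => Complex.exp (-μ k * (t : ℂ)))
        (Complex.exp (-μ k * (t : ℂ)) * (-μ k * 1)) t :=
      ((Complex.ofRealCLM.hasDerivAt (x := t)).const_mul (-μ k)).cexp
    exact (this.const_mul _).mul_const _
  -- As `H` is real, the real part solves the same equation; as `x` is real, it still starts at `x`.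
  refine ⟨fun t i => (Z t i).re, ?_, ?_, ?_⟩
  · ext i
    have : Z 0 i = (x i : ℂ) := by
      simp only [hZ, Complex.ofReal_zero, mul_zero, Complex.exp_zero, mul_one, Finset.sum_mul]
      rw [Finset.sum_comm]
      have : ∀ i' : Fin n, ∑ k, v k i' * (x i' : ℂ) * w k i =
          (x i' : ℂ) * (if i' = i then 1 else 0) := by
        intro i'
        rw [← h.resolution, Finset.mul_sum]
        exact Finset.sum_congr rfl fun k _ => by ring
      simp [this]
    simp [this]
  · intro t
    rw [hasDerivAt_pi]
    intro i
    have h1 : HasDerivAt (fun t => (Z t i).re) (((complexify H)ᵀ *ᵥ Z t) i).re t :=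
      Complex.reCLM.hasFDerivAt.comp_hasDerivAt t (hZd t i)
    convert! h1 using 1
    simp [Matrix.mulVec, dotProduct]
  · rw [tendsto_pi_nhds]
    intro i
    have : Filter.Tendsto (fun t => Z t i) Filter.atTop (nhds 0) := by
      have : (0 : ℂ) = ∑ k : Fin n, (∑ i', v k i' * (x i' : ℂ)) * 0 * w k i := by simp
      rw [this]
      refine tendsto_finsetSum _ fun k _ => ?_
      refine Filter.Tendsto.mul_const _ (Filter.Tendsto.const_mul _ ?_)
      rw [tendsto_zero_iff_norm_tendsto_zero]
      simp only [Complex.norm_exp]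
      refine Real.tendsto_exp_atBot.comp ?_
      have : (fun t : ℝ => (-μ k * (t : ℂ)).re) = fun t => (-(μ k).re) * t := by
        ext t; simp
      rw [this]
      exact Filter.tendsto_id.const_mul_atTop_of_neg (by linarith [hμ k])
    simpa [Function.comp_def] using (Complex.continuous_re.tendsto 0).comp this

lemma hasDerivAt_mulVec_apply {n : ℕ} (M : Matrix (Fin n) (Fin n) ℝ) {X : ℝ → Fin n → ℝ}
    {X' : Fin n → ℝ} {t : ℝ} (hX : HasDerivAt X X' t) (i : Fin n) :
    HasDerivAt (fun t => (M *ᵥ X t) i) ((M *ᵥ X') i) t := by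
  simp only [Matrix.mulVec, dotProduct]
  exact HasDerivAt.fun_sum fun j _ => (hasDerivAt_pi.1 hX j).const_mul (M i j)

/-- A symmetric solution of the Lyapunov equation is positive definite if the matrix is stable and
the pair is controllable. -/
lemma posDef_of_lyapunov {n : ℕ} {H B Γ : Matrix (Fin n) (Fin n) ℝ} (hB : B.PosSemidef)
    (hc : Controllable H B)
    (hflow : ∀ x : Fin n → ℝ, ∃ X : ℝ → Fin n → ℝ, X 0 = x ∧
      (∀ t, HasDerivAt X (Hᵀ *ᵥ X t) t) ∧ Filter.Tendsto X Filter.atTop (nhds 0))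
    (hΓ : Γᵀ = Γ) (hL : H * Γ + Γ * Hᵀ = -B) : Γ.PosDef := by
  refine Matrix.PosDef.of_dotProduct_mulVec_pos (by simpa [Matrix.IsHermitian] using hΓ) ?_
  intro x hx
  obtain ⟨X, hX0, hXd, hXl⟩ := hflow x
  -- Lyapunov function: its derivative along the flow is `-⟨X, B X⟩ ≤ 0` and it tends to `0`, so it
  -- is non-negative throughout.
  set f : ℝ → ℝ := fun t => X t ⬝ᵥ Γ *ᵥ X t with hf
  have hfd : ∀ t, HasDerivAt f (-(X t ⬝ᵥ B *ᵥ X t)) t := by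
    intro t
    have h1 : ∀ i, HasDerivAt (fun t => X t i) ((Hᵀ *ᵥ X t) i) t := hasDerivAt_pi.1 (hXd t)
    have h2 : ∀ i, HasDerivAt (fun t => (Γ *ᵥ X t) i) ((Γ *ᵥ (Hᵀ *ᵥ X t)) i) t :=
      hasDerivAt_mulVec_apply Γ (hXd t)
    have h3 : HasDerivAt f (∑ i, ((Hᵀ *ᵥ X t) i * (Γ *ᵥ X t) i
        + X t i * (Γ *ᵥ (Hᵀ *ᵥ X t)) i)) t :=
      HasDerivAt.fun_sum fun i _ => (h1 i).mul (h2 i)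
    convert! h3 using 1
    have e : B = -(H * Γ + Γ * Hᵀ) := by rw [hL]; simp
    rw [e, Finset.sum_add_distrib]
    change _ = (Hᵀ *ᵥ X t) ⬝ᵥ (Γ *ᵥ X t) + X t ⬝ᵥ (Γ *ᵥ (Hᵀ *ᵥ X t))
    rw [Matrix.neg_mulVec, dotProduct_neg, neg_neg, Matrix.add_mulVec, dotProduct_add,
      Matrix.mulVec_mulVec, ← Matrix.mulVec_mulVec _ H, Matrix.dotProduct_mulVec _ H,
      Matrix.mulVec_transpose]
  have hnn : ∀ z : Fin n → ℝ, 0 ≤ z ⬝ᵥ B *ᵥ z := fun z => by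
    simpa using hB.dotProduct_mulVec_nonneg z
  have hanti : Antitone f := antitone_of_hasDerivAt_nonpos hfd
    (fun t => by simpa using hnn (X t))
  have hcont : Continuous (fun z : Fin n → ℝ => z ⬝ᵥ Γ *ᵥ z) := by fun_prop
  have hlim : Filter.Tendsto f Filter.atTop (nhds 0) := by
    simpa [hf, Function.comp_def] using (hcont.tendsto 0).comp hXl
  have hge : ∀ t, 0 ≤ f t := fun t => hanti.le_of_tendsto hlim t
  have hfx : f 0 = x ⬝ᵥ Γ *ᵥ x := by rw [hf]; simp [hX0]
  simp only [star_trivial]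
  rw [← hfx]
  -- If `f` vanishes at `0`, it vanishes at all later times, and so does its derivative;
  -- semidefiniteness then gives `B X = 0` along the flow.
  refine lt_of_le_of_ne (hge 0) fun h0 => hx ?_
  have hf0 : ∀ t, 0 < t → f t = 0 := fun t ht =>
    le_antisymm (h0 ▸ hanti ht.le) (hge t)
  have hBX : ∀ t, 0 < t → B *ᵥ X t = 0 := by
    intro t ht
    have h1 : f =ᶠ[nhds t] fun _ => 0 := by
      filter_upwards [lt_mem_nhds ht] with s hs using hf0 s hs
    have h2 := (hfd t).unique ((hasDerivAt_const t (0 : ℝ)).congr_of_eventuallyEq h1)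
    have h3 : X t ⬝ᵥ B *ᵥ X t = 0 := by linarith
    exact (hB.dotProduct_mulVec_zero_iff (X t)).1 (by simpa using h3)
  have hXc : Continuous X := continuous_iff_continuousAt.2 fun t => (hXd t).continuousAt
  -- Each time derivative of `B X = 0` brings out one more factor `Hᵀ`. The limit `t → 0+` then
  -- gives the transposed form of the hypothesis of controllability for `x`.
  have hk : ∀ k : ℕ, ∀ t, 0 < t → (B * Hᵀ ^ k) *ᵥ X t = 0 := by
    intro k
    induction k with
    | zero => simpa using hBX
    | succ k ih =>
      intro t ht
      ext i
      have h2 : HasDerivAt (fun t => ((B * Hᵀ ^ k) *ᵥ X t) i)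
          (((B * Hᵀ ^ k) *ᵥ (Hᵀ *ᵥ X t)) i) t :=
        hasDerivAt_mulVec_apply _ (hXd t) i
      have h3 : (fun t => ((B * Hᵀ ^ k) *ᵥ X t) i) =ᶠ[nhds t] fun _ => 0 := by
        filter_upwards [lt_mem_nhds ht] with s hs using by rw [ih s hs]; rfl
      have h4 := h2.unique ((hasDerivAt_const t (0 : ℝ)).congr_of_eventuallyEq h3)
      rw [Matrix.mulVec_mulVec, Matrix.mul_assoc, ← pow_succ] at h4
      exact h4
  apply hc x
  intro k _
  have h1 : (B * Hᵀ ^ k) *ᵥ x = 0 := by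
    have hg : Continuous fun t => (B * Hᵀ ^ k) *ᵥ X t := by fun_prop
    have l1 : Filter.Tendsto (fun t => (B * Hᵀ ^ k) *ᵥ X t) (nhdsWithin 0 (Set.Ioi 0))
        (nhds ((B * Hᵀ ^ k) *ᵥ x)) := by
      have := (hg.tendsto 0).mono_left (nhdsWithin_le_nhds (s := Set.Ioi (0 : ℝ)))
      rwa [hX0] at this
    refine tendsto_nhds_unique (l1.congr' ?_) tendsto_const_nhds
    filter_upwards [self_mem_nhdsWithin] with t ht using hk k t ht
  have hBt : Bᵀ = B := by simpa [Matrix.IsHermitian] using hB.isHermitian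
  rw [← Matrix.mulVec_transpose, Matrix.transpose_mul, hBt, Matrix.transpose_pow]
  exact h1

/-- A solution of a real Lyapunov equation is real and symmetric. -/
lemma exists_real_of_lyapunov {n : ℕ} {H B : Matrix (Fin n) (Fin n) ℝ} {μ : Fin n → ℂ}
    (hμ : ∀ k, 0 < (μ k).re) (hB : Bᵀ = B) {v : Fin n → Fin n → ℂ}
    (hv : ∀ k, complexify H *ᵥ v k = (-μ k) • v k)
    (hdet : IsUnit (Matrix.of fun i k => v k i).det) {X : Matrix (Fin n) (Fin n) ℂ}
    (hX : complexify H * X + X * (complexify H)ᵀ = -complexify B) :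
    ∃ Γ : Matrix (Fin n) (Fin n) ℝ, complexify Γ = X ∧ Γᵀ = Γ ∧ H * Γ + Γ * Hᵀ = -B := by
  have hBc : (complexify B)ᵀ = complexify B := by rw [complexify, ← Matrix.transpose_map, hB]
  -- The transpose of `X`, and below its conjugate transpose, solve the same Lyapunov equation,
  -- because `H` and `B` are real and `B` is symmetric. Uniqueness makes `X` symmetric and
  -- Hermitian, hence real.
  have hsymm : Xᵀ = X := by
    rw [← sub_eq_zero]
    apply lyapunov_unique hμ hv hdet
    have := congrArg Matrix.transpose hX
    simp only [Matrix.transpose_add, Matrix.transpose_mul, Matrix.transpose_transpose,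
      Matrix.transpose_neg, hBc] at this
    rw [← hX] at this
    rw [Matrix.mul_sub, Matrix.sub_mul]
    calc _ = (X * (complexify H)ᵀ)ᵀ + (complexify H * X)ᵀ
          - (complexify H * X + X * (complexify H)ᵀ) := by
          simp only [Matrix.transpose_mul, Matrix.transpose_transpose]; abel
      _ = 0 := by
          simp only [Matrix.transpose_mul, Matrix.transpose_transpose]
          rw [← this]; abel
  have hherm : Xᴴ = X := by
    rw [← sub_eq_zero]
    apply lyapunov_unique hμ hv hdet
    have := congrArg Matrix.conjTranspose hX
    have hHT : ((complexify H)ᵀ)ᴴ = complexify H := by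
      rw [← complexify_conjTranspose, Matrix.conjTranspose_conjTranspose]
    simp only [Matrix.conjTranspose_add, Matrix.conjTranspose_mul, hHT, complexify_conjTranspose,
      Matrix.conjTranspose_neg, hBc] at this
    rw [← hX] at this
    rw [Matrix.mul_sub, Matrix.sub_mul]
    calc _ = complexify H * Xᴴ + Xᴴ * (complexify H)ᵀ
          - (complexify H * X + X * (complexify H)ᵀ) := by abel
      _ = 0 := by rw [← this]; abel
  have hreal : ∀ i j, (((X i j).re : ℝ) : ℂ) = X i j := by
    intro i j
    apply Complex.conj_eq_iff_re.1
    have h1 := congrFun (congrFun hherm j) i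
    have h2 := congrFun (congrFun hsymm j) i
    simp only [Matrix.conjTranspose_apply, Matrix.transpose_apply] at h1 h2
    exact h1.trans h2.symm
  have hc : complexify (Matrix.of fun i j => (X i j).re) = X := by
    ext i j
    simpa using hreal i j
  refine ⟨_, hc, ?_, ?_⟩
  · ext i j
    have := congrFun (congrFun hsymm i) j
    simp only [Matrix.transpose_apply] at this
    simp [this]
  · ext i j
    have := congrFun (congrFun hX i) j
    rw [← hc] at this
    simp only [Matrix.add_apply, Matrix.mul_apply, Matrix.neg_apply, Matrix.map_apply,
      Matrix.transpose_apply] at this ⊢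
    exact_mod_cast this

/-- The ladder operators `𝓛₋ₖ` are the derivatives along an eigenbasis of `H`, and `Σ` is the
inverse of a real positive definite solution of the Lyapunov equation. -/
theorem BasicConditions.ladder_structure {n : ℕ} {H B : Matrix (Fin n) (Fin n) ℝ} {μ : Fin n → ℂ}
    (hHB : BasicConditions H B μ) {yp ym : Fin n → Idx n → ℂ}
    (hyp : ∀ k, IsLadderVector B H (μ k) (yp k))
    (hym : ∀ k, IsLadderVector B H (-μ k) (ym k)) :
    (∀ k, qPart (ym k) = 0) ∧ (∀ k u, ym k (Sum.inr u) = 0) ∧ IsUnit (matP yp).det ∧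
    ∃ (w : Fin n → Fin n → ℂ) (Γ : Matrix (Fin n) (Fin n) ℝ),
      DualEigenbasis H μ (fun k => pPart (ym k)) w ∧ H * Γ + Γ * Hᵀ = -B ∧ Γ.PosDef ∧
      matSigma yp = complexify Γ⁻¹ := by
  have hμ := hHB.re_pos
  have hμ0 : ∀ k, μ k ≠ 0 := fun k h => by simpa [h] using hμ k
  have hinj : Function.Injective fun k => -μ k := neg_injective.comp hHB.injective
  have hB : Bᵀ = B := by simpa [Matrix.IsHermitian] using hHB.posSemidef.isHermitian
  choose e he using fun k => (hHB.hasEigenvalue k).exists_hasEigenvector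
  have he1 : ∀ k, complexify H *ᵥ e k = (-μ k) • e k := fun k => by
    have := (he k).1
    rw [Module.End.mem_eigenspace_iff] at this
    simpa using this
  have hedet := isUnit_det_of_eigenvectors hinj he1 fun k => (he k).2
  -- All eigenvalues of `Hᵀ` lie in the left half plane.
  have hT0 : ∀ (q : Fin n → ℂ) (ν : ℂ), 0 < ν.re → (complexify H)ᵀ *ᵥ q = ν • q → q = 0 := by
    intro q ν hν hq
    by_contra hq0
    obtain ⟨k, hk⟩ := eigenvalue_transpose_mem he1 hedet hq0 hq
    rw [hk] at hν
    simp at hν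
    linarith [hμ k]
  have hq : ∀ k, qPart (ym k) = 0 := fun k =>
    hT0 _ (μ k) (hμ k) (by simpa using (hym k).q_eq)
  have hv : ∀ k, complexify H *ᵥ pPart (ym k) = (-μ k) • pPart (ym k) := fun k => by
    simpa [hq k] using (hym k).p_eq
  have hvdet := isUnit_det_of_eigenvectors hinj hv
    fun k => (hym k).ne_zero (neg_ne_zero.2 (hμ0 k)) (hq k)
  obtain ⟨w, hw⟩ := exists_dualEigenbasis hv hvdet
  have hwdet : IsUnit (Matrix.of fun i k => w k i).det := by
    refine isUnit_det_of_eigenvectors hinj hw.eigen_w fun k h0 => ?_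
    simpa [h0] using hw.dual k k
  -- If `q` were zero, `p` would be an eigenvector of `H` for `μ k`, in the right half plane.
  have hqp : ∀ k, qPart (yp k) ≠ 0 := by
    intro k h0
    have h1 := (hyp k).p_eq
    rw [h0, Matrix.mulVec_zero, add_zero] at h1
    obtain ⟨j, hj⟩ := eigenvalue_transpose_mem (M := (complexify H)ᵀ) hw.eigen_w hwdet
      ((hyp k).ne_zero (hμ0 k) h0) (by simpa using h1)
    have := hμ k
    rw [hj] at this
    simp at this
    linarith [hμ j]
  have hQdet : IsUnit (matQ yp).det :=
    isUnit_det_of_eigenvectors hinj (fun k => (hyp k).q_eq) hqp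
  have hHP : complexify H * matP yp + complexify B * matQ yp = matP yp * Matrix.diagonal μ := by
    ext i k
    have := congrFun (hyp k).p_eq i
    rw [Matrix.mul_diagonal]
    simpa [Matrix.mul_apply, Matrix.mulVec, dotProduct, matP, matQ, pPart, qPart, mul_comm]
      using this
  have hHQ : (complexify H)ᵀ * matQ yp = -(matQ yp * Matrix.diagonal μ) := by
    ext i k
    have := congrFun (hyp k).q_eq i
    rw [Matrix.neg_apply, Matrix.mul_diagonal]
    simpa [Matrix.mul_apply, Matrix.mulVec, dotProduct, matQ, qPart, mul_comm]
      using this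
  have hQQ := Matrix.mul_nonsing_inv _ hQdet
  have hQQ' := Matrix.nonsing_inv_mul _ hQdet
  -- With `M = diag μ`, the relations `HP + BQ = PM` and `HᵀQ = -QM` make the two terms `P M Q⁻¹ -
  -- B` and `-P M Q⁻¹`.
  have hlyap : complexify H * (matP yp * (matQ yp)⁻¹) +
      (matP yp * (matQ yp)⁻¹) * (complexify H)ᵀ = -complexify B := by
    have h1 : (matQ yp)⁻¹ * (complexify H)ᵀ = -(Matrix.diagonal μ * (matQ yp)⁻¹) := by
      calc _ = (matQ yp)⁻¹ * ((complexify H)ᵀ * matQ yp) * (matQ yp)⁻¹ := by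
            rw [Matrix.mul_assoc, Matrix.mul_assoc, hQQ, Matrix.mul_one]
        _ = -(((matQ yp)⁻¹ * matQ yp) * Matrix.diagonal μ * (matQ yp)⁻¹) := by
            rw [hHQ]; simp [Matrix.mul_assoc]
        _ = _ := by rw [hQQ', Matrix.one_mul]
    have h2 : complexify H * matP yp = matP yp * Matrix.diagonal μ - complexify B * matQ yp := by
      rw [← hHP]; abel
    rw [← Matrix.mul_assoc, h2, Matrix.mul_assoc, h1, Matrix.sub_mul, Matrix.mul_assoc _ (matQ yp),
      hQQ]
    rw [Matrix.mul_assoc, Matrix.mul_one, Matrix.mul_neg]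
    abel
  obtain ⟨Γ, hΓc, hΓs, hΓl⟩ := exists_real_of_lyapunov hμ hB hv hvdet hlyap
  have hpos := posDef_of_lyapunov hHB.posSemidef hHB.controllable (hw.exists_flow hμ) hΓs hΓl
  have hΓu : IsUnit Γ.det := hpos.det_pos.ne'.isUnit
  have hP : matP yp = complexify Γ * matQ yp := by
    rw [hΓc, Matrix.mul_assoc, hQQ', Matrix.mul_one]
  have hinv : complexify Γ * complexify Γ⁻¹ = 1 := by
    have := congrArg complexify (Matrix.mul_nonsing_inv _ hΓu)
    rwa [complexify_mul, complexify_one] at this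
  refine ⟨hq, fun k u => (hym k).r_eq (neg_ne_zero.2 (hμ0 k)) u, ?_, w, Γ, hw, hΓl, hpos, ?_⟩
  · rw [hP, Matrix.det_mul]
    refine IsUnit.mul ?_ hQdet
    exact Matrix.isUnit_det_of_right_inverse hinv
  · rw [matSigma, hP, Matrix.mul_inv_rev, ← Matrix.mul_assoc, hQQ, Matrix.one_mul]
    exact Matrix.inv_eq_right_inv hinv

/-! ### Calculus of partial derivatives and commutators with the Fokker–Planck operator. -/

section Calculus

variable {n : ℕ}

lemma two_le_smooth : (2 : ℕ∞ω) ≤ ∞ := by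
  exact WithTop.coe_le_coe.2 (le_top : (2 : ℕ∞) ≤ ⊤)

/-- The derivative of a function along a complex vector. -/
def dirD (v : Fin n → ℂ) (f : Space n → ℂ) : Space n → ℂ := fun s => ∑ j, v j * partialD j f s

lemma fderiv_apply_eq_sum (f : Space n → ℂ) (s x : Space n) :
    fderiv ℝ f s x = ∑ j, (x j : ℂ) * partialD j f s := by
  have h : x = ∑ j, x j • EuclideanSpace.single j (1 : ℝ) := by
    ext i
    simp [Pi.single_apply]
  conv_lhs => rw [h]
  simp [partialD]

lemma ContDiff.partialD {m k : ℕ∞ω} {f : Space n → ℂ} (hf : ContDiff ℝ k f) (hk : m + 1 ≤ k)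
    (j : Fin n) : ContDiff ℝ m (partialD j f) :=
  (hf.fderiv_right hk).clm_apply contDiff_const

lemma ContDiff.dirD {m k : ℕ∞ω} {f : Space n → ℂ} (hf : ContDiff ℝ k f) (hk : m + 1 ≤ k)
    (v : Fin n → ℂ) : ContDiff ℝ m (dirD v f) :=
  ContDiff.sum fun j _ => contDiff_const.mul (ContDiff.partialD hf hk j)

lemma contDiff_coord {m : ℕ∞ω} (i : Fin n) : ContDiff ℝ m fun s : Space n => (s i : ℂ) :=
  (Complex.ofRealCLM.comp (EuclideanSpace.proj (𝕜 := ℝ) i)).contDiff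

@[fun_prop]
lemma differentiable_coord (i : Fin n) : Differentiable ℝ fun s : Space n => (s i : ℂ) :=
  (contDiff_coord (m := 1) i).differentiable one_ne_zero

lemma partialD_coord (i j : Fin n) (s : Space n) :
    partialD j (fun s : Space n => (s i : ℂ)) s = if i = j then 1 else 0 := by
  have := (Complex.ofRealCLM.comp (EuclideanSpace.proj (𝕜 := ℝ) i)).fderiv (x := s)
  change fderiv ℝ (Complex.ofRealCLM.comp (EuclideanSpace.proj (𝕜 := ℝ) i)) s _ = _
  rw [this]
  simp [apply_ite]

lemma partialD_const (j : Fin n) (c : ℂ) (s : Space n) :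
    partialD j (fun _ : Space n => c) s = 0 := by
  simp [partialD]

lemma partialD_add (j : Fin n) {f g : Space n → ℂ} {s : Space n} (hf : DifferentiableAt ℝ f s)
    (hg : DifferentiableAt ℝ g s) :
    partialD j (fun t => f t + g t) s = partialD j f s + partialD j g s := by
  simp [partialD, fderiv_fun_add hf hg]

lemma partialD_sub (j : Fin n) {f g : Space n → ℂ} {s : Space n} (hf : DifferentiableAt ℝ f s)
    (hg : DifferentiableAt ℝ g s) :
    partialD j (fun t => f t - g t) s = partialD j f s - partialD j g s := by
  simp [partialD, fderiv_fun_sub hf hg]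

lemma partialD_mul (j : Fin n) {f g : Space n → ℂ} {s : Space n} (hf : DifferentiableAt ℝ f s)
    (hg : DifferentiableAt ℝ g s) :
    partialD j (fun t => f t * g t) s = partialD j f s * g s + f s * partialD j g s := by
  simp [partialD, fderiv_fun_mul hf hg]
  ring

lemma partialD_const_mul (j : Fin n) (c : ℂ) {f : Space n → ℂ} {s : Space n}
    (hf : DifferentiableAt ℝ f s) :
    partialD j (fun t => c * f t) s = c * partialD j f s := by
  simp [partialD, fderiv_const_mul hf]

lemma partialD_sum {ι : Type*} (u : Finset ι) (j : Fin n) {f : ι → Space n → ℂ} {s : Space n}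
    (hf : ∀ i ∈ u, DifferentiableAt ℝ (f i) s) :
    partialD j (fun t => ∑ i ∈ u, f i t) s = ∑ i ∈ u, partialD j (f i) s := by
  simp [partialD, fderiv_fun_sum hf]

lemma partialD_congr (j : Fin n) {f g : Space n → ℂ} {s : Space n} (h : f =ᶠ[nhds s] g) :
    partialD j f s = partialD j g s := by
  simp [partialD, h.fderiv_eq]

lemma partialD_cexp (j : Fin n) {f : Space n → ℂ} {s : Space n} (hf : DifferentiableAt ℝ f s) :
    partialD j (fun t => Complex.exp (f t)) s = partialD j f s * Complex.exp (f s) := by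
  simp [partialD, hf.hasFDerivAt.cexp.fderiv, mul_comm]

lemma partialD_comm {f : Space n → ℂ} (hf : ContDiff ℝ 2 f) (i j : Fin n) (s : Space n) :
    partialD i (partialD j f) s = partialD j (partialD i f) s := by
  have hd : DifferentiableAt ℝ (fderiv ℝ f) s :=
    ((hf.fderiv_right (m := 1) (by norm_num)).differentiable one_ne_zero) s
  have h : ∀ i j : Fin n, partialD i (partialD j f) s =
      fderiv ℝ (fderiv ℝ f) s (EuclideanSpace.single i 1) (EuclideanSpace.single j 1) := by
    intro i j
    change fderiv ℝ (fun t => fderiv ℝ f t (EuclideanSpace.single j 1)) s _ = _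
    rw [fderiv_clm_apply hd (differentiableAt_const _)]
    simp
  rw [h, h]
  exact (hf.contDiffAt.isSymmSndFDerivAt (by simp)).eq _ _

/-- The Fokker–Planck operator in non-divergence form. -/
lemma fokkerPlanck_eq (B H : Matrix (Fin n) (Fin n) ℝ) {f : Space n → ℂ} (hf : ContDiff ℝ 2 f)
    (s : Space n) :
    fokkerPlanck B H f s = (1 / 2 : ℂ) * ∑ i, ∑ j, (B i j : ℂ) * partialD i (partialD j f) s
      - ((H.trace : ℂ) * f s + ∑ i, ∑ j, (H i j : ℂ) * (s j : ℂ) * partialD i f s) := by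
  have hd : Differentiable ℝ f := hf.differentiable two_ne_zero
  have hd' : ∀ j, Differentiable ℝ (partialD j f) := fun j =>
    (ContDiff.partialD (m := 1) hf (by norm_num) j).differentiable one_ne_zero
  simp only [fokkerPlanck, divergence]
  congr 1
  · congr 1
    refine Finset.sum_congr rfl fun i _ => ?_
    rw [partialD_sum]
    · exact Finset.sum_congr rfl fun j _ => partialD_const_mul _ _ (hd' j s)
    · exact fun j _ => ((hd' j s).const_mul _)
  · have h : ∀ i, partialD i (fun t : Space n => (∑ j, (H i j : ℂ) * (t j : ℂ)) * f t) s =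
        (H i i : ℂ) * f s + ∑ j, (H i j : ℂ) * (s j : ℂ) * partialD i f s := by
      intro i
      rw [partialD_mul i (by fun_prop) (hd s), partialD_sum _ _ (by fun_prop)]
      have : ∀ j, partialD i (fun t : Space n => (H i j : ℂ) * (t j : ℂ)) s =
          (H i j : ℂ) * if j = i then 1 else 0 := fun j => by
        rw [partialD_const_mul _ _ (by fun_prop), partialD_coord]
      simp [this, Finset.sum_mul]
    simp only [h, Finset.sum_add_distrib]
    rw [← Finset.sum_mul]
    simp [Matrix.trace]

lemma fokkerPlanck_sum (B H : Matrix (Fin n) (Fin n) ℝ) {ι : Type*} (u : Finset ι) (c : ι → ℂ)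
    {f : ι → Space n → ℂ} (hf : ∀ k, ContDiff ℝ 2 (f k)) (s : Space n) :
    fokkerPlanck B H (fun t => ∑ k ∈ u, c k * f k t) s =
      ∑ k ∈ u, c k * fokkerPlanck B H (f k) s := by
  have hd : ∀ k, Differentiable ℝ (f k) := fun k => (hf k).differentiable two_ne_zero
  have hd' : ∀ k j, Differentiable ℝ (partialD j (f k)) := fun k j =>
    (ContDiff.partialD (m := 1) (hf k) (by norm_num) j).differentiable one_ne_zero
  have e1 : ∀ j, partialD j (fun t => ∑ k ∈ u, c k * f k t) =
      fun t => ∑ k ∈ u, c k * partialD j (f k) t := by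
    intro j
    ext t
    rw [partialD_sum _ _ fun k _ => (hd k t).const_mul _]
    exact Finset.sum_congr rfl fun k _ => partialD_const_mul _ _ (hd k t)
  have e2 : ∀ i j, partialD i (fun t => ∑ k ∈ u, c k * partialD j (f k) t) s =
      ∑ k ∈ u, c k * partialD i (partialD j (f k)) s := by
    intro i j
    rw [partialD_sum _ _ fun k _ => (hd' k j s).const_mul _]
    exact Finset.sum_congr rfl fun k _ => partialD_const_mul _ _ (hd' k j s)
  have hcomm : ∀ F : Fin n → Fin n → ι → ℂ, ∑ i, ∑ j, ∑ k ∈ u, F i j k =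
      ∑ k ∈ u, ∑ i, ∑ j, F i j k := fun F =>
    (Finset.sum_congr rfl fun i _ => Finset.sum_comm).trans Finset.sum_comm
  rw [fokkerPlanck_eq B H (ContDiff.sum fun k _ => contDiff_const.mul (hf k))]
  simp only [fokkerPlanck_eq B H (hf _), e1, e2]
  simp only [mul_sub, mul_add, Finset.sum_sub_distrib, Finset.sum_add_distrib, Finset.mul_sum,
    hcomm]
  congr 1
  · exact Finset.sum_congr rfl fun k _ => Finset.sum_congr rfl fun i _ =>
      Finset.sum_congr rfl fun j _ => by ring
  congr 1
  · exact Finset.sum_congr rfl fun k _ => by ring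
  · exact Finset.sum_congr rfl fun k _ => Finset.sum_congr rfl fun i _ =>
      Finset.sum_congr rfl fun j _ => by ring

/-- Differentiation along an eigenvector of `H` is a ladder operator. -/
lemma fokkerPlanck_partialD (B H : Matrix (Fin n) (Fin n) ℝ) {f : Space n → ℂ}
    (hf : ContDiff ℝ ∞ f) (k : Fin n) (s : Space n) :
    fokkerPlanck B H (partialD k f) s =
      partialD k (fokkerPlanck B H f) s + ∑ i, (H i k : ℂ) * partialD i f s := by
  have h2 : ∀ {g : Space n → ℂ}, ContDiff ℝ ∞ g → ContDiff ℝ 2 g := fun hg =>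
    hg.of_le two_le_smooth
  have hd : ∀ {g : Space n → ℂ}, ContDiff ℝ ∞ g → Differentiable ℝ g := fun hg =>
    hg.differentiable (by simp)
  have hp : ∀ {g : Space n → ℂ} j, ContDiff ℝ ∞ g → ContDiff ℝ ∞ (partialD j g) := fun j hg =>
    ContDiff.partialD hg (by simp) j
  have hc : ∀ i j, partialD i (partialD j f) = partialD j (partialD i f) := fun i j =>
    funext (partialD_comm (h2 hf) i j)
  have hd1 := fun j => hd (hp j hf)
  have hd2 := fun i j => hd (hp i (hp j hf))
  rw [fokkerPlanck_eq B H (h2 (hp k hf)),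
    show fokkerPlanck B H f = _ from funext (fokkerPlanck_eq B H (h2 hf))]
  rw [partialD_sub, partialD_const_mul, partialD_add, partialD_const_mul _ _ (hd hf s),
    partialD_sum, partialD_sum]
  · have e1 : ∀ i, partialD k (fun t => ∑ j, (B i j : ℂ) * partialD i (partialD j f) t) s =
        ∑ j, (B i j : ℂ) * partialD i (partialD j (partialD k f)) s := by
      intro i
      rw [partialD_sum _ _ fun j _ => (hd2 i j s).const_mul _]
      refine Finset.sum_congr rfl fun j _ => ?_
      rw [partialD_const_mul _ _ (hd2 i j s), partialD_comm (h2 (hp j hf)), hc k j]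
    have e2 : ∀ i, partialD k (fun t : Space n => ∑ j, (H i j : ℂ) * (t j : ℂ) * partialD i f t) s =
        (H i k : ℂ) * partialD i f s +
          ∑ j, (H i j : ℂ) * (s j : ℂ) * partialD i (partialD k f) s := by
      intro i
      rw [partialD_sum _ _ fun j _ => by have := hd1 i; fun_prop]
      have : ∀ j, partialD k (fun t : Space n => (H i j : ℂ) * (t j : ℂ) * partialD i f t) s =
          (if j = k then (H i j : ℂ) * partialD i f s else 0) +
            (H i j : ℂ) * (s j : ℂ) * partialD i (partialD k f) s := by
        intro j
        rw [partialD_mul _ (by fun_prop) (hd1 i s), partialD_const_mul _ _ (by fun_prop),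
          partialD_coord, hc k i]
        split_ifs <;> simp
      simp [this, Finset.sum_add_distrib]
    simp only [e1, e2, Finset.sum_add_distrib]
    ring
  all_goals
    have := hd hf
    intros
    fun_prop

/-- The commutator of `𝒟` with `∂_k` comes only from differentiating the linear drift coefficients
and is the derivative along the `k`-th column of `H`; hence the commutator with the derivative along
`v` is the derivative along `H v`. -/
lemma fokkerPlanck_dirD (B H : Matrix (Fin n) (Fin n) ℝ) {f : Space n → ℂ}
    (hf : ContDiff ℝ ∞ f) {v : Fin n → ℂ} {lam : ℂ} (hv : complexify H *ᵥ v = lam • v)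
    (s : Space n) :
    fokkerPlanck B H (dirD v f) s = dirD v (fokkerPlanck B H f) s + lam * dirD v f s := by
  have hp : ∀ k, ContDiff ℝ 2 (partialD k f) := fun k =>
    (ContDiff.partialD (m := ∞) hf (by simp) k).of_le two_le_smooth
  unfold dirD
  rw [fokkerPlanck_sum B H _ _ hp]
  simp only [fokkerPlanck_partialD B H hf, mul_add, Finset.sum_add_distrib, Finset.mul_sum]
  congr 1
  rw [Finset.sum_comm]
  refine Finset.sum_congr rfl fun i _ => ?_
  have := congrFun hv i
  simp only [Matrix.mulVec, dotProduct, Pi.smul_apply, smul_eq_mul, Matrix.map_apply] at this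
  rw [← mul_assoc, ← this, Finset.sum_mul]
  exact Finset.sum_congr rfl fun k _ => by ring

end Calculus

/-! ### Gaussians, polynomial multiples of them, and their moments. -/

section Gaussian

variable {n : ℕ}

/-- The function `exp (-½ ⟨s, S s⟩)` for a real matrix `S`. -/
def gaussian (S : Matrix (Fin n) (Fin n) ℝ) : Space n → ℂ :=
  fun s => Complex.exp (-(1 / 2 : ℂ) * ∑ i, ∑ j, (s i : ℂ) * (S i j : ℂ) * (s j : ℂ))

lemma contDiff_gaussian (S : Matrix (Fin n) (Fin n) ℝ) : ContDiff ℝ ∞ (gaussian S) := by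
  refine ContDiff.cexp (contDiff_const.mul ?_)
  exact ContDiff.sum fun i _ => ContDiff.sum fun j _ =>
    ((contDiff_coord i).mul contDiff_const).mul (contDiff_coord j)

lemma partialD_gaussian {S : Matrix (Fin n) (Fin n) ℝ} (hS : Sᵀ = S) (k : Fin n) (s : Space n) :
    partialD k (gaussian S) s = -(∑ j, (S k j : ℂ) * (s j : ℂ)) * gaussian S s := by
  unfold gaussian
  rw [partialD_cexp _ (by fun_prop), partialD_const_mul _ _ (by fun_prop)]
  congr 1
  have e : ∀ i j : Fin n, partialD k (fun t : Space n => (t i : ℂ) * (S i j : ℂ) * (t j : ℂ)) s =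
      (if i = k then (S k j : ℂ) * (s j : ℂ) else 0) +
        if j = k then (S k i : ℂ) * (s i : ℂ) else 0 := by
    intro i j
    rw [partialD_mul _ (by fun_prop) (by fun_prop), partialD_mul _ (by fun_prop) (by fun_prop),
      partialD_const, partialD_coord, partialD_coord]
    have : S i k = S k i := congrFun (congrFun hS k) i
    split_ifs with h1 h2 h2
    · subst h1 h2; ring
    · subst h1; ring
    · subst h2; rw [this]; ring
    · ring
  rw [partialD_sum _ _ (by fun_prop)]
  have : ∀ i, partialD k (fun t : Space n => ∑ j, (t i : ℂ) * (S i j : ℂ) * (t j : ℂ)) s =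
      ∑ j, ((if i = k then (S k j : ℂ) * (s j : ℂ) else 0) +
        if j = k then (S k i : ℂ) * (s i : ℂ) else 0) := by
    intro i
    rw [partialD_sum _ _ (by fun_prop)]
    exact Finset.sum_congr rfl fun j _ => e i j
  simp only [this, Finset.sum_add_distrib]
  rw [Finset.sum_comm]
  simp
  ring

/-- The Gaussian with the inverse stationary covariance matrix is a stationary density. -/
lemma fokkerPlanck_gaussian {B H Γ : Matrix (Fin n) (Fin n) ℝ}
    (hL : H * Γ + Γ * Hᵀ = -B) (hΓ : Γ.PosDef) (s : Space n) :
    fokkerPlanck B H (gaussian Γ⁻¹) s = 0 := by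
  set S := Γ⁻¹ with hS
  have hΓs : Γᵀ = Γ := by simpa [Matrix.IsHermitian] using hΓ.isHermitian
  have hSs : Sᵀ = S := by rw [hS, Matrix.transpose_nonsing_inv, hΓs]
  have hΓu : IsUnit Γ.det := hΓ.det_pos.ne'.isUnit
  have h1 := Matrix.mul_nonsing_inv _ hΓu
  have h2 := Matrix.nonsing_inv_mul _ hΓu
  rw [← hS] at h1 h2
  -- Two consequences of the Lyapunov equation suffice: this one cancels the part quadratic in `s`,
  -- and the trace identity `htr` cancels the constant part.
  have hB : S * B * S = -(S * H + Hᵀ * S) := by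
    have : B = -(H * Γ + Γ * Hᵀ) := by rw [hL]; simp
    rw [this, Matrix.mul_neg, Matrix.neg_mul, Matrix.mul_add, Matrix.add_mul, ← Matrix.mul_assoc S Γ,
      h2, Matrix.one_mul]
    simp only [Matrix.mul_assoc, h1, Matrix.mul_one]
  have htr : (B * S).trace = -(2 * H.trace) := by
    have : B = -(H * Γ + Γ * Hᵀ) := by rw [hL]; simp
    rw [this, Matrix.neg_mul, Matrix.trace_neg, Matrix.add_mul, Matrix.trace_add, Matrix.mul_assoc,
      h1, Matrix.mul_one, Matrix.mul_assoc, Matrix.trace_mul_comm Γ, Matrix.mul_assoc, h2,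
      Matrix.mul_one, Matrix.trace_transpose]
    ring
  set x : Fin n → ℝ := fun i => s i with hx
  have hquad : (S *ᵥ x) ⬝ᵥ (B *ᵥ (S *ᵥ x)) = -(2 * ((H *ᵥ x) ⬝ᵥ (S *ᵥ x))) := by
    have e1 : (S *ᵥ x) ⬝ᵥ (B *ᵥ (S *ᵥ x)) = x ⬝ᵥ ((S * B * S) *ᵥ x) := by
      rw [Matrix.mul_assoc, ← Matrix.mulVec_mulVec, ← Matrix.mulVec_mulVec,
        Matrix.dotProduct_mulVec x S, ← Matrix.mulVec_transpose, hSs]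
    have e2 : x ⬝ᵥ ((S * H) *ᵥ x) = (H *ᵥ x) ⬝ᵥ (S *ᵥ x) := by
      rw [← Matrix.mulVec_mulVec, Matrix.dotProduct_mulVec x S, ← Matrix.mulVec_transpose, hSs,
        dotProduct_comm]
    have e3 : x ⬝ᵥ ((Hᵀ * S) *ᵥ x) = (H *ᵥ x) ⬝ᵥ (S *ᵥ x) := by
      rw [← Matrix.mulVec_mulVec, Matrix.dotProduct_mulVec x, Matrix.vecMul_transpose]
    rw [e1, hB, Matrix.neg_mulVec, dotProduct_neg, Matrix.add_mulVec, dotProduct_add, e2, e3]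
    ring
  have hsm := contDiff_gaussian S
  have hd : Differentiable ℝ (gaussian S) := hsm.differentiable (by simp)
  have hD : ∀ j, partialD j (gaussian S) =
      fun s => -(∑ l, (S j l : ℂ) * (s l : ℂ)) * gaussian S s := fun j =>
    funext fun s => partialD_gaussian hSs j s
  have hDD : ∀ i j, partialD i (partialD j (gaussian S)) s =
      (-(S j i : ℂ) + (((S *ᵥ x) i * (S *ᵥ x) j : ℝ) : ℂ)) * gaussian S s := by
    intro i j
    rw [hD, partialD_mul _ (by fun_prop) (hd s), partialD_gaussian hSs]
    have e : partialD i (fun t : Space n => -(∑ l, (S j l : ℂ) * (t l : ℂ))) s = -(S j i : ℂ) := by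
      have : (fun t : Space n => -(∑ l, (S j l : ℂ) * (t l : ℂ))) =
          fun t : Space n => ∑ l, (-(S j l : ℂ)) * (t l : ℂ) := by
        ext t; simp
      rw [this, partialD_sum _ _ (by fun_prop)]
      have : ∀ l, partialD i (fun t : Space n => (-(S j l : ℂ)) * (t l : ℂ)) s =
          (-(S j l : ℂ)) * if l = i then 1 else 0 := fun l => by
        rw [partialD_const_mul _ _ (by fun_prop), partialD_coord]
      rw [Finset.sum_congr rfl fun l _ => this l]
      simp
    rw [e]
    simp only [Matrix.mulVec, dotProduct, hx]
    push_cast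
    ring
  rw [fokkerPlanck_eq B H (hsm.of_le two_le_smooth)]
  have hsum1 : ∑ i, ∑ j, (B i j : ℂ) * partialD i (partialD j (gaussian S)) s =
      ((-(B * S).trace + (S *ᵥ x) ⬝ᵥ (B *ᵥ (S *ᵥ x)) : ℝ) : ℂ) * gaussian S s := by
    simp only [hDD]
    have : -(B * S).trace + (S *ᵥ x) ⬝ᵥ (B *ᵥ (S *ᵥ x)) =
        ∑ i, ∑ j, B i j * (-S j i + (S *ᵥ x) i * (S *ᵥ x) j) := by
      simp only [mul_add, Finset.sum_add_distrib, Matrix.trace, Matrix.diag, Matrix.mul_apply]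
      congr 1
      · simp
      · simp only [dotProduct]
        refine Finset.sum_congr rfl fun i _ => ?_
        rw [show (B *ᵥ (S *ᵥ x)) i = ∑ j, B i j * (S *ᵥ x) j from rfl, Finset.mul_sum]
        exact Finset.sum_congr rfl fun j _ => by ring
    rw [this]
    push_cast
    simp only [Finset.sum_mul]
    exact Finset.sum_congr rfl fun i _ => Finset.sum_congr rfl fun j _ => by ring
  have hsum2 : ∑ i, ∑ j, (H i j : ℂ) * (s j : ℂ) * partialD i (gaussian S) s =
      -((((H *ᵥ x) ⬝ᵥ (S *ᵥ x) : ℝ)) : ℂ) * gaussian S s := by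
    have : (H *ᵥ x) ⬝ᵥ (S *ᵥ x) = ∑ i, (∑ j, H i j * x j) * (S *ᵥ x) i := rfl
    rw [this]
    push_cast
    rw [← Finset.sum_neg_distrib, Finset.sum_mul]
    refine Finset.sum_congr rfl fun i _ => ?_
    rw [hD]
    simp only [Matrix.mulVec, dotProduct, hx]
    push_cast
    rw [← Finset.sum_mul]
    ring
  rw [hsum1, hsum2, htr, hquad]
  push_cast
  ring

/-- A polynomial times the Gaussian `exp (-½ ⟨s, S s⟩)`. -/
def polyGaussian (S : Matrix (Fin n) (Fin n) ℝ) (p : MvPolynomial (Fin n) ℂ) : Space n → ℂ :=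
  fun s => MvPolynomial.eval (fun i => (s i : ℂ)) p * gaussian S s

lemma contDiff_eval (p : MvPolynomial (Fin n) ℂ) :
    ContDiff ℝ ∞ fun s : Space n => MvPolynomial.eval (fun i => (s i : ℂ)) p := by
  induction p using MvPolynomial.induction_on with
  | C a => simpa using contDiff_const
  | add p q hp hq => simpa using hp.add hq
  | mul_X p i hp => simpa using hp.mul (contDiff_coord i)

lemma contDiff_polyGaussian (S : Matrix (Fin n) (Fin n) ℝ) (p : MvPolynomial (Fin n) ℂ) :
    ContDiff ℝ ∞ (polyGaussian S p) :=
  (contDiff_eval p).mul (contDiff_gaussian S)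

lemma partialD_eval (k : Fin n) (p : MvPolynomial (Fin n) ℂ) (s : Space n) :
    partialD k (fun s : Space n => MvPolynomial.eval (fun i => (s i : ℂ)) p) s =
      MvPolynomial.eval (fun i => (s i : ℂ)) (MvPolynomial.pderiv k p) := by
  have hd : ∀ p : MvPolynomial (Fin n) ℂ,
      Differentiable ℝ fun s : Space n => MvPolynomial.eval (fun i => (s i : ℂ)) p := fun p =>
    (contDiff_eval p).differentiable (by simp)
  induction p using MvPolynomial.induction_on with
  | C a => simp [partialD_const]
  | add p q hp hq =>
    simp only [map_add]
    rw [partialD_add _ (hd p s) (hd q s), hp, hq]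
  | mul_X p i hp =>
    simp only [map_mul, MvPolynomial.eval_X, Derivation.leibniz, map_add, smul_eq_mul]
    rw [partialD_mul _ (hd p s) (by fun_prop), hp, partialD_coord, MvPolynomial.pderiv_X]
    by_cases h : i = k
    · subst h; simp; ring
    · simp [h]; ring

lemma exists_partialD_polyGaussian {S : Matrix (Fin n) (Fin n) ℝ} (hS : Sᵀ = S) (k : Fin n)
    (p : MvPolynomial (Fin n) ℂ) : ∃ q, partialD k (polyGaussian S p) = polyGaussian S q := by
  -- Product rule: differentiating the Gaussian brings down `-(S s)_k`.
  refine ⟨MvPolynomial.pderiv k p - p * ∑ j, MvPolynomial.C (S k j : ℂ) * MvPolynomial.X j, ?_⟩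
  ext s
  unfold polyGaussian
  rw [partialD_mul _ ((contDiff_eval p).differentiable (by simp) s)
    ((contDiff_gaussian S).differentiable (by simp) s), partialD_eval, partialD_gaussian hS]
  simp
  ring

lemma exists_dirD_polyGaussian {S : Matrix (Fin n) (Fin n) ℝ} (hS : Sᵀ = S) (v : Fin n → ℂ)
    (p : MvPolynomial (Fin n) ℂ) : ∃ q, dirD v (polyGaussian S p) = polyGaussian S q := by
  choose q hq using fun k => exists_partialD_polyGaussian hS k p
  refine ⟨∑ k, MvPolynomial.C (v k) * q k, ?_⟩
  ext s
  simp [dirD, hq, polyGaussian, Finset.sum_mul, mul_assoc]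

lemma exists_eval_bound (p : MvPolynomial (Fin n) ℂ) : ∃ (C : ℝ) (N : ℕ), ∀ s : Space n,
    ‖MvPolynomial.eval (fun i => (s i : ℂ)) p‖ ≤ C * (1 + ‖s‖) ^ N := by
  induction p using MvPolynomial.induction_on with
  | C a => exact ⟨‖a‖, 0, fun s => by simp⟩
  | add p q hp hq =>
    obtain ⟨C, N, h⟩ := hp
    obtain ⟨C', N', h'⟩ := hq
    refine ⟨|C| + |C'|, N + N', fun s => ?_⟩
    have h1 : (1 : ℝ) ≤ 1 + ‖s‖ := by linarith [norm_nonneg s]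
    have a1 : (1 + ‖s‖) ^ N ≤ (1 + ‖s‖) ^ (N + N') := pow_le_pow_right₀ h1 (by omega)
    have a2 : (1 + ‖s‖) ^ N' ≤ (1 + ‖s‖) ^ (N + N') := pow_le_pow_right₀ h1 (by omega)
    rw [map_add]
    calc _ ≤ C * (1 + ‖s‖) ^ N + C' * (1 + ‖s‖) ^ N' :=
          (norm_add_le _ _).trans (add_le_add (h s) (h' s))
      _ ≤ |C| * (1 + ‖s‖) ^ (N + N') + |C'| * (1 + ‖s‖) ^ (N + N') := by
          gcongr <;> exact le_abs_self _
      _ = _ := by ring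
  | mul_X p i hp =>
    obtain ⟨C, N, h⟩ := hp
    refine ⟨C, N + 1, fun s => ?_⟩
    rw [map_mul, norm_mul, MvPolynomial.eval_X, pow_succ, ← mul_assoc]
    refine mul_le_mul (h s) ?_ (norm_nonneg _) ((norm_nonneg _).trans (h s))
    have : ‖s i‖ ≤ ‖s‖ := PiLp.norm_apply_le s i
    rw [Complex.norm_real]
    linarith

/-- A positive definite quadratic form is bounded below by a multiple of the squared norm. -/
lemma exists_quadForm_lower_bound {S : Matrix (Fin n) (Fin n) ℝ} (hS : S.PosDef) :
    ∃ a > 0, ∀ s : Space n, a * ‖s‖ ^ 2 ≤ ∑ i, ∑ j, s i * S i j * s j := by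
  set Q : Space n → ℝ := fun s => ∑ i, ∑ j, s i * S i j * s j with hQ
  have hQc : Continuous Q := by fun_prop
  have hpos : ∀ s : Space n, s ≠ 0 → 0 < Q s := by
    intro s hs
    have h1 : (fun i => s i) ≠ 0 := fun h => hs (by ext i; exact congrFun h i)
    have := hS.dotProduct_mulVec_pos h1
    simp only [star_trivial, dotProduct, Matrix.mulVec, Finset.mul_sum] at this
    simpa [hQ, mul_assoc] using this
  have hhom : ∀ (c : ℝ) (s : Space n), Q (c • s) = c ^ 2 * Q s := by
    intro c s
    simp only [hQ, PiLp.smul_apply, smul_eq_mul, Finset.mul_sum]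
    exact Finset.sum_congr rfl fun i _ => Finset.sum_congr rfl fun j _ => by ring
  have h0 : Q 0 = 0 := by simp [hQ]
  -- The constant is the minimum on the unit sphere, extended by homogeneity. The sphere is empty
  -- only when the space is a single point.
  by_cases hne : (Metric.sphere (0 : Space n) 1).Nonempty
  · obtain ⟨z, hz, hmin⟩ := (isCompact_sphere (0 : Space n) 1).exists_isMinOn hne hQc.continuousOn
    have hz1 : ‖z‖ = 1 := by simpa using hz
    refine ⟨Q z, hpos z (by intro h; simp [h] at hz1), fun s => ?_⟩
    by_cases hs : s = 0
    · simp [hs]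
    have hn : ‖s‖ ≠ 0 := norm_ne_zero_iff.2 hs
    have h1 : Q z ≤ Q (‖s‖⁻¹ • s) := hmin (by simp [norm_smul, hn])
    rw [hhom] at h1
    have h2 : Q z * ‖s‖ ^ 2 ≤ (‖s‖⁻¹ ^ 2 * Q s) * ‖s‖ ^ 2 := by gcongr
    have h3 : (‖s‖⁻¹ ^ 2 * Q s) * ‖s‖ ^ 2 = Q s := by field_simp
    rwa [h3] at h2
  · refine ⟨1, one_pos, fun s => ?_⟩
    have hs : s = 0 := by
      by_contra hs
      exact hne ⟨‖s‖⁻¹ • s, by simp [norm_smul, hs]⟩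
    simp [hs]

lemma norm_gaussian (S : Matrix (Fin n) (Fin n) ℝ) (s : Space n) :
    ‖gaussian S s‖ = Real.exp (-(1 / 2) * ∑ i, ∑ j, s i * S i j * s j) := by
  rw [gaussian, Complex.norm_exp]
  congr 1
  have : (-(1 / 2 : ℂ) * ∑ i, ∑ j, (s i : ℂ) * (S i j : ℂ) * (s j : ℂ)) =
    ((-(1 / 2) * ∑ i, ∑ j, s i * S i j * s j : ℝ) : ℂ) := by push_cast; ring
  rw [this, Complex.ofReal_re]

/-- Half of the Gaussian decay absorbs the power: `(1 + r)^M ≤ M! exp (1 + r)`, and completing the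
square gives `r ≤ (a/2) r² + 1/(2a)`. -/
lemma pow_mul_exp_neg_sq_le {a r : ℝ} (ha : 0 < a) (hr : 0 ≤ r) (M : ℕ) :
    (1 + r) ^ M * Real.exp (-a * r ^ 2) ≤
      M.factorial * Real.exp (1 + 1 / (2 * a)) * Real.exp (-(a / 2) * r ^ 2) := by
  have h1 : (1 + r) ^ M ≤ M.factorial * Real.exp (1 + r) := by
    have := Real.pow_div_factorial_le_exp (1 + r) (by linarith) M
    rw [div_le_iff₀ (by positivity)] at this
    linarith
  have h2 : (1 + r) + -a * r ^ 2 ≤ (1 + 1 / (2 * a)) + -(a / 2) * r ^ 2 := by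
    have : 0 ≤ (a / 2) * (r - 1 / a) ^ 2 := by positivity
    have e : (a / 2) * (r - 1 / a) ^ 2 = (a / 2) * r ^ 2 - r + 1 / (2 * a) := by
      field_simp
      ring
    linarith
  calc _ ≤ (M.factorial * Real.exp (1 + r)) * Real.exp (-a * r ^ 2) := by gcongr
    _ = M.factorial * Real.exp ((1 + r) + -a * r ^ 2) := by
        rw [Real.exp_add (1 + r)]; ring
    _ ≤ M.factorial * Real.exp ((1 + 1 / (2 * a)) + -(a / 2) * r ^ 2) := by gcongr
    _ = _ := by rw [Real.exp_add (1 + 1 / (2 * a))]; ring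

lemma integrable_exp_neg_mul_norm_sq {b : ℝ} (hb : 0 < b) :
    Integrable fun s : Space n => Real.exp (-b * ‖s‖ ^ 2) := by
  have := (GaussianFourier.integrable_cexp_neg_mul_sq_norm_add (V := Space n) (b := (b : ℂ))
    (by simpa) 0 0).norm
  refine this.congr (Filter.Eventually.of_forall fun s => ?_)
  simp only [Complex.norm_exp]
  congr 1
  simp [← Complex.ofReal_pow]

lemma hasAllMoments_polyGaussian {S : Matrix (Fin n) (Fin n) ℝ} (hS : S.PosDef)
    (p : MvPolynomial (Fin n) ℂ) : HasAllMoments (polyGaussian S p) := by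
  intro m
  obtain ⟨a, ha, hQ⟩ := exists_quadForm_lower_bound hS
  obtain ⟨C, N, hp⟩ := exists_eval_bound p
  have hcont : Continuous fun s : Space n => ((‖s‖ ^ m : ℝ) : ℂ) * polyGaussian S p s := by
    have := (contDiff_eval p).continuous
    have := (contDiff_gaussian S).continuous
    unfold polyGaussian
    fun_prop
  -- One half comes from the factor `½` in the exponent of the Gaussian, the other is spent on
  -- absorbing the polynomial growth.
  have hi := (integrable_exp_neg_mul_norm_sq (n := n) (b := a / 2 / 2) (by positivity)).const_mul
    (|C| * ((m + N).factorial * Real.exp (1 + 1 / (2 * (a / 2)))))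
  refine hi.mono' hcont.aestronglyMeasurable (Filter.Eventually.of_forall fun s => ?_)
  have hs := norm_nonneg s
  rw [norm_mul, polyGaussian, norm_mul, norm_gaussian, Complex.norm_real, norm_pow, norm_norm]
  have h1 : Real.exp (-(1 / 2) * ∑ i, ∑ j, s i * S i j * s j) ≤
      Real.exp (-(a / 2) * ‖s‖ ^ 2) := by
    apply Real.exp_le_exp.2
    linarith [hQ s]
  have h2 := pow_mul_exp_neg_sq_le (half_pos ha) hs (m + N)
  calc _ ≤ (1 + ‖s‖) ^ m * ((|C| * (1 + ‖s‖) ^ N) * Real.exp (-(a / 2) * ‖s‖ ^ 2)) := by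
        gcongr
        · linarith
        · exact (hp s).trans (by gcongr; exact le_abs_self C)
    _ = |C| * ((1 + ‖s‖) ^ (m + N) * Real.exp (-(a / 2) * ‖s‖ ^ 2)) := by ring
    _ ≤ |C| * ((m + N).factorial * Real.exp (1 + 1 / (2 * (a / 2))) *
          Real.exp (-(a / 2 / 2) * ‖s‖ ^ 2)) := by gcongr
    _ = _ := by ring

end Gaussian

/-! ### The functions `Φ_k` as iterated directional derivatives of the stationary Gaussian. -/

section Tower

variable {n : ℕ}

/-- Induction along the applications of the lowering operators that build `Φ_k`. -/
lemma PhiK_induction {yp ym : Fin n → Idx n → ℂ} {C : (Fin n → ℕ) → (Space n → ℂ) → Prop}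
    (zero : C 0 (Phi0 yp))
    (step : ∀ k f j, C k f → C (k + Pi.single j 1) (ladderOp (ym j) f)) (k : Fin n → ℕ) :
    C k (PhiK yp ym k) := by
  have hiter : ∀ (j : Fin n) (m : ℕ) (k' : Fin n → ℕ) (f : Space n → ℂ), C k' f →
      C (Pi.single j m + k') ((ladderOp (ym j))^[m] f) := by
    intro j m k' f hf
    induction m with
    | zero => simpa using hf
    | succ m ih =>
      rw [Function.iterate_succ_apply']
      have := step _ _ j ih
      rwa [add_right_comm, ← Pi.single_add] at this
  -- Generalising to an arbitrary list makes the fold accessible to induction; over the full list of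
  -- indices the exponents add up to `k`.
  have hlist : ∀ l : List (Fin n), C (l.map fun j => Pi.single j (k j)).sum
      (l.foldr (fun j f => (ladderOp (ym j))^[k j] f) (Phi0 yp)) := by
    intro l
    induction l with
    | nil => simpa using zero
    | cons j l ih =>
      rw [List.map_cons, List.sum_cons, List.foldr_cons]
      exact hiter j (k j) _ _ ih
  have := hlist (List.finRange n)
  rw [← List.ofFn_eq_map, List.sum_ofFn, Finset.univ_sum_single] at this
  exact this

lemma ladderOp_eq_dirD {y : Idx n → ℂ} (hq : qPart y = 0) (hr : ∀ u, y (Sum.inr u) = 0)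
    (f : Space n → ℂ) : ladderOp y f = dirD (pPart y) f := by
  have hq' : ∀ i, y (Sum.inl (Sum.inr i)) = 0 := fun i => congrFun hq i
  ext s
  simp [ladderOp, Fintype.sum_sum_type, hq', hr, dirD, pPart, basicOp]

lemma chiK_add_single (μ : Fin n → ℂ) (k : Fin n → ℕ) (j : Fin n) :
    chiK μ (k + Pi.single j 1) = chiK μ k - μ j := by
  have : ∀ i, (((k + Pi.single j 1 : Fin n → ℕ) i : ℕ) : ℂ) * μ i =
      (k i : ℂ) * μ i + if i = j then μ i else 0 := by
    intro i
    by_cases h : i = j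
    · subst h; simp; ring
    · simp [h]
  simp only [chiK, this, Finset.sum_add_distrib]
  simp
  ring

/-- `Φ_k` is a polynomial times a Gaussian and solves the eigenvalue equation. -/
lemma PhiK_properties {B H Γ : Matrix (Fin n) (Fin n) ℝ} {μ : Fin n → ℂ}
    {yp ym : Fin n → Idx n → ℂ} (hq : ∀ k, qPart (ym k) = 0) (hr : ∀ k u, ym k (Sum.inr u) = 0)
    (hv : ∀ k, complexify H *ᵥ pPart (ym k) = (-μ k) • pPart (ym k))
    (hL : H * Γ + Γ * Hᵀ = -B) (hΓ : Γ.PosDef) (hS : matSigma yp = complexify Γ⁻¹)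
    (k : Fin n → ℕ) :
    ContDiff ℝ ∞ (PhiK yp ym k) ∧ (∃ p, PhiK yp ym k = polyGaussian Γ⁻¹ p) ∧
      ∀ s, fokkerPlanck B H (PhiK yp ym k) s = chiK μ k * PhiK yp ym k s := by
  have hΓs : Γᵀ = Γ := by simpa [Matrix.IsHermitian] using hΓ.isHermitian
  have hSs : (Γ⁻¹)ᵀ = Γ⁻¹ := by rw [Matrix.transpose_nonsing_inv, hΓs]
  have h0 : Phi0 yp = gaussian Γ⁻¹ := by
    ext s; simp [Phi0, gaussian, hS]
  refine PhiK_induction (C := fun k f => ContDiff ℝ ∞ f ∧ (∃ p, f = polyGaussian Γ⁻¹ p) ∧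
      ∀ s, fokkerPlanck B H f s = chiK μ k * f s) ?_ ?_ k
  · rw [h0]
    refine ⟨contDiff_gaussian _, ⟨1, ?_⟩, fun s => ?_⟩
    · ext s; simp [polyGaussian]
    · rw [fokkerPlanck_gaussian hL hΓ]; simp [chiK]
  · rintro k f j ⟨hf, ⟨p, hp⟩, he⟩
    rw [ladderOp_eq_dirD (hq j) (hr j)]
    refine ⟨ContDiff.dirD hf (by simp) _, ?_, fun s => ?_⟩
    · rw [hp]; exact exists_dirD_polyGaussian hSs _ p
    · have hfd : Differentiable ℝ f := hf.differentiable (by simp)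
      rw [fokkerPlanck_dirD B H hf (hv j), chiK_add_single,
        show fokkerPlanck B H f = fun s => chiK μ k * f s from funext he]
      have : dirD (pPart (ym j)) (fun s => chiK μ k * f s) s =
          chiK μ k * dirD (pPart (ym j)) f s := by
        simp only [dirD, Finset.mul_sum]
        exact Finset.sum_congr rfl fun i _ => by rw [partialD_const_mul _ _ (hfd s)]; ring
      rw [this]
      ring

end Tower

/-! ### Smooth solutions of `⟨Hᵀξ, ∇u⟩ = χ u` for stable `H`. -/

section Homogeneous

variable {n : ℕ}

/-- The derivative of `u` along the linear vector field `ξ ↦ Hᵀ ξ`. -/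
def linearFieldD (H : Matrix (Fin n) (Fin n) ℝ) (u : Space n → ℂ) : Space n → ℂ :=
  fun ξ => ∑ i, ∑ j, (H j i : ℂ) * (ξ j : ℂ) * partialD i u ξ

/-- The complex linear coordinate `⟨v, ξ⟩`. -/
def coordAlong (v : Fin n → ℂ) : Space n → ℂ := fun ξ => ∑ i, v i * (ξ i : ℂ)

/-- The monomial with exponents `k` in the coordinates along the vectors `v j`. -/
def coordMonomial (v : Fin n → Fin n → ℂ) (k : Fin n → ℕ) : Space n → ℂ :=
  fun ξ => ∏ j, coordAlong (v j) ξ ^ k j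

lemma linearFieldD_eq_fderiv (H : Matrix (Fin n) (Fin n) ℝ) (u : Space n → ℂ) (x : Fin n → ℝ) :
    linearFieldD H u (WithLp.toLp 2 x) =
      fderiv ℝ u (WithLp.toLp 2 x) (WithLp.toLp 2 (Hᵀ *ᵥ x)) := by
  rw [fderiv_apply_eq_sum]
  refine Finset.sum_congr rfl fun i _ => ?_
  simp [Matrix.mulVec, dotProduct, Finset.sum_mul]

lemma linearFieldD_partialD (H : Matrix (Fin n) (Fin n) ℝ) {u : Space n → ℂ} {χ : ℂ}
    (hu : ContDiff ℝ ∞ u) (heq : ∀ ξ, linearFieldD H u ξ = χ * u ξ) (k : Fin n) (ξ : Space n) :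
    linearFieldD H (partialD k u) ξ = χ * partialD k u ξ - ∑ i, (H k i : ℂ) * partialD i u ξ := by
  have hd : Differentiable ℝ u := hu.differentiable (by simp)
  have hd1 : ∀ i, Differentiable ℝ (partialD i u) := fun i =>
    (ContDiff.partialD (m := ∞) hu (by simp) i).differentiable (by simp)
  have h1 : partialD k (linearFieldD H u) ξ = χ * partialD k u ξ := by
    rw [show linearFieldD H u = fun ξ => χ * u ξ from funext heq, partialD_const_mul _ _ (hd ξ)]
  have h2 : partialD k (linearFieldD H u) ξ =
      ∑ i, (H k i : ℂ) * partialD i u ξ + linearFieldD H (partialD k u) ξ := by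
    unfold linearFieldD
    rw [partialD_sum _ _ fun i _ => by have := hd1 i; fun_prop, ← Finset.sum_add_distrib]
    refine Finset.sum_congr rfl fun i _ => ?_
    rw [partialD_sum _ _ fun j _ => by have := hd1 i; fun_prop]
    have : ∀ j, partialD k (fun t : Space n => (H j i : ℂ) * (t j : ℂ) * partialD i u t) ξ =
        (if j = k then (H j i : ℂ) * partialD i u ξ else 0) +
          (H j i : ℂ) * (ξ j : ℂ) * partialD i (partialD k u) ξ := by
      intro j
      rw [partialD_mul _ (by fun_prop) (hd1 i ξ), partialD_const_mul _ _ (by fun_prop),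
        partialD_coord, partialD_comm (hu.of_le two_le_smooth) k i]
      split_ifs <;> simp
    rw [Finset.sum_congr rfl fun j _ => this j, Finset.sum_add_distrib]
    simp
  rw [h1] at h2
  rw [h2]
  ring

lemma linearFieldD_sum (H : Matrix (Fin n) (Fin n) ℝ) (c : Fin n → ℂ) {f : Fin n → Space n → ℂ}
    (hf : ∀ k, Differentiable ℝ (f k)) (ξ : Space n) :
    linearFieldD H (fun t => ∑ k, c k * f k t) ξ = ∑ k, c k * linearFieldD H (f k) ξ := by
  have e : ∀ i, partialD i (fun t => ∑ k, c k * f k t) ξ = ∑ k, c k * partialD i (f k) ξ := by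
    intro i
    rw [partialD_sum _ _ fun k _ => (hf k ξ).const_mul _]
    exact Finset.sum_congr rfl fun k _ => partialD_const_mul _ _ (hf k ξ)
  simp only [linearFieldD, e, Finset.mul_sum]
  rw [Finset.sum_congr rfl fun i _ => Finset.sum_comm, Finset.sum_comm]
  exact Finset.sum_congr rfl fun k _ => Finset.sum_congr rfl fun i _ =>
    Finset.sum_congr rfl fun j _ => by ring

variable {H : Matrix (Fin n) (Fin n) ℝ} {μ : Fin n → ℂ} {v w : Fin n → Fin n → ℂ}

/-- Since `Hᵀ w j = -μ j w j`, the derivative along `w j` shifts `χ` to the right by `μ j`, towards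
the half plane where only the zero solution exists. -/
lemma DualEigenbasis.linearFieldD_dirD (h : DualEigenbasis H μ v w) {u : Space n → ℂ} {χ : ℂ}
    (hu : ContDiff ℝ ∞ u) (heq : ∀ ξ, linearFieldD H u ξ = χ * u ξ) (j : Fin n) (ξ : Space n) :
    linearFieldD H (dirD (w j) u) ξ = (χ + μ j) * dirD (w j) u ξ := by
  have hd1 : ∀ i, Differentiable ℝ (partialD i u) := fun i =>
    (ContDiff.partialD (m := ∞) hu (by simp) i).differentiable (by simp)
  unfold dirD
  rw [linearFieldD_sum H _ hd1]
  simp only [linearFieldD_partialD H hu heq, mul_sub, Finset.sum_sub_distrib]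
  have h1 : ∑ k, w j k * ∑ i, (H k i : ℂ) * partialD i u ξ = -μ j * ∑ i, w j i * partialD i u ξ := by
    simp only [Finset.mul_sum]
    rw [Finset.sum_comm]
    refine Finset.sum_congr rfl fun i _ => ?_
    have := congrFun (h.eigen_w j) i
    simp only [Matrix.mulVec, dotProduct, Pi.smul_apply, smul_eq_mul, Matrix.map_apply,
      Matrix.transpose_apply] at this
    rw [← mul_assoc, ← this, Finset.sum_mul]
    exact Finset.sum_congr rfl fun k _ => by ring
  have h2 : ∑ k, w j k * (χ * partialD k u ξ) = χ * ∑ k, w j k * partialD k u ξ := by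
    rw [Finset.mul_sum]
    exact Finset.sum_congr rfl fun k _ => by ring
  rw [h1, h2]
  ring

/-- Weighted Euler formula, from the expansion `Hᵀξ = -∑ μ j ⟨v j, ξ⟩ w j`. It recovers a solution
with `χ ≠ 0` from its derivatives along the `w j`. -/
lemma DualEigenbasis.linearFieldD_eq (h : DualEigenbasis H μ v w) (u : Space n → ℂ)
    (ξ : Space n) :
    linearFieldD H u ξ = ∑ j, -μ j * (coordAlong (v j) ξ * dirD (w j) u ξ) := by
  have h1 : ∀ i, ∑ l, (H l i : ℂ) * (ξ l : ℂ) = ∑ j, -μ j * coordAlong (v j) ξ * w j i := by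
    intro i
    have e : ∀ j, -μ j * w j i = ∑ l, (H l i : ℂ) * w j l := fun j => by
      have := congrFun (h.eigen_w j) i
      simpa [Matrix.mulVec, dotProduct] using this.symm
    calc ∑ l, (H l i : ℂ) * (ξ l : ℂ)
        = ∑ l, (H l i : ℂ) * ∑ i', (ξ i' : ℂ) * ∑ j, v j i' * w j l := by
          simp [h.resolution]
      _ = ∑ l, ∑ i', ∑ j, v j i' * (ξ i' : ℂ) * ((H l i : ℂ) * w j l) := by
          simp only [Finset.mul_sum]
          exact Finset.sum_congr rfl fun _ _ => Finset.sum_congr rfl fun _ _ =>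
            Finset.sum_congr rfl fun _ _ => by ring
      _ = ∑ j, ∑ i', ∑ l, v j i' * (ξ i' : ℂ) * ((H l i : ℂ) * w j l) := by
          rw [Finset.sum_comm, Finset.sum_congr rfl fun _ _ => Finset.sum_comm, Finset.sum_comm]
      _ = ∑ j, -μ j * coordAlong (v j) ξ * w j i := by
          refine Finset.sum_congr rfl fun j _ => ?_
          rw [mul_right_comm, e j, coordAlong, mul_comm, Finset.sum_mul]
          exact Finset.sum_congr rfl fun _ _ => by rw [Finset.mul_sum]
  unfold linearFieldD
  simp only [← Finset.sum_mul, h1]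
  simp only [dirD, Finset.sum_mul, Finset.mul_sum]
  rw [Finset.sum_comm]
  exact Finset.sum_congr rfl fun _ _ => Finset.sum_congr rfl fun _ _ => by ring

/-- Along the flow of `Hᵀ` a solution of `linearFieldD H u = χ u` is an exponential. -/
lemma DualEigenbasis.exists_tendsto (h : DualEigenbasis H μ v w) (hμ : ∀ k, 0 < (μ k).re)
    {u : Space n → ℂ} {χ : ℂ} (hu : ContDiff ℝ 1 u) (heq : ∀ ξ, linearFieldD H u ξ = χ * u ξ)
    (ξ : Space n) : Filter.Tendsto (fun t : ℝ => Complex.exp (χ * t) * u ξ) Filter.atTop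
      (nhds (u 0)) := by
  obtain ⟨X, hX0, hXd, hXl⟩ := h.exists_flow hμ (fun i => ξ i)
  set g : ℝ → ℂ := fun t => u (WithLp.toLp 2 (X t)) with hg
  have hgd : ∀ t, HasDerivAt g (χ * g t) t := by
    intro t
    have h1 : HasDerivAt (fun t => (WithLp.toLp 2 (X t) : Space n))
        (WithLp.toLp 2 (Hᵀ *ᵥ X t)) t :=
      (PiLp.continuousLinearEquiv 2 ℝ fun _ : Fin n => ℝ).symm.hasFDerivAt.comp_hasDerivAt t (hXd t)
    have h2 := (hu.differentiable one_ne_zero (WithLp.toLp 2 (X t))).hasFDerivAt.comp_hasDerivAt t h1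
    rw [← linearFieldD_eq_fderiv, heq] at h2
    exact h2
  -- Restricted to a trajectory, the equation is `g' = χ g`.
  have hconst : ∀ t : ℝ, Complex.exp (-χ * t) * g t = u ξ := by
    intro t
    have hd : ∀ t : ℝ, HasDerivAt (fun t : ℝ => Complex.exp (-χ * t) * g t) 0 t := by
      intro t
      have h1 : HasDerivAt (fun t : ℝ => Complex.exp (-χ * (t : ℂ)))
          (Complex.exp (-χ * (t : ℂ)) * (-χ * 1)) t :=
        ((Complex.ofRealCLM.hasDerivAt (x := t)).const_mul (-χ)).cexp
      convert! h1.mul (hgd t) using 1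
      ring
    have := is_const_of_deriv_eq_zero (fun t => (hd t).differentiableAt) (fun t => (hd t).deriv) t 0
    rw [this]
    simp [hg, hX0]
  have hlim : Filter.Tendsto g Filter.atTop (nhds (u 0)) := by
    have hc : Continuous fun x : Fin n → ℝ => u (WithLp.toLp 2 x) :=
      hu.continuous.comp (PiLp.continuous_toLp 2 _)
    simpa [hg, Function.comp_def] using (hc.tendsto 0).comp hXl
  refine hlim.congr fun t => ?_
  rw [← hconst t, ← mul_assoc, ← Complex.exp_add]
  simp

/-- A non-zero value of `u` would grow like `exp (χ t)` along a trajectory, whereas continuity at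
the origin makes the values along it converge to `u 0`. -/
lemma DualEigenbasis.eq_zero_of_re_pos (h : DualEigenbasis H μ v w) (hμ : ∀ k, 0 < (μ k).re)
    {u : Space n → ℂ} {χ : ℂ} (hu : ContDiff ℝ 1 u) (heq : ∀ ξ, linearFieldD H u ξ = χ * u ξ)
    (hχ : 0 < χ.re) : u = 0 := by
  ext ξ
  have h1 := h.exists_tendsto hμ hu heq ξ
  have h2 : Filter.Tendsto (fun t : ℝ => Complex.exp (-χ * t)) Filter.atTop (nhds 0) := by
    rw [tendsto_zero_iff_norm_tendsto_zero]
    simp only [Complex.norm_exp]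
    refine Real.tendsto_exp_atBot.comp ?_
    have : (fun t : ℝ => (-χ * (t : ℂ)).re) = fun t => (-χ.re) * t := by
      ext t; simp
    rw [this]
    exact Filter.tendsto_id.const_mul_atTop_of_neg (by linarith)
  have h3 := h2.mul h1
  rw [zero_mul] at h3
  refine tendsto_nhds_unique (tendsto_const_nhds.congr fun t => ?_) h3
  rw [← mul_assoc, ← Complex.exp_add]
  simp

lemma DualEigenbasis.eq_const_of_zero (h : DualEigenbasis H μ v w) (hμ : ∀ k, 0 < (μ k).re)
    {u : Space n → ℂ} (hu : ContDiff ℝ 1 u) (heq : ∀ ξ, linearFieldD H u ξ = 0)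
    (ξ : Space n) : u ξ = u 0 := by
  have h1 := h.exists_tendsto hμ hu (χ := 0) (by simpa using heq) ξ
  exact tendsto_nhds_unique (by simp) h1

lemma coordAlong_mul_coordMonomial (v : Fin n → Fin n → ℂ) (k : Fin n → ℕ) (j : Fin n) :
    coordAlong (v j) * coordMonomial v k = coordMonomial v (k + Pi.single j 1) := by
  ext ξ
  have : ∀ i, coordAlong (v i) ξ ^ ((k + Pi.single j 1 : Fin n → ℕ) i) =
      (if i = j then coordAlong (v i) ξ else 1) * coordAlong (v i) ξ ^ k i := by
    intro i
    by_cases h : i = j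
    · subst h; simp [pow_succ, mul_comm]
    · simp [h]
  simp only [Pi.mul_apply, coordMonomial, this, Finset.prod_mul_distrib]
  simp

/-- Smooth solutions of `linearFieldD H u = χ u` for a stable matrix `H` are polynomials. -/
theorem DualEigenbasis.mem_span_coordMonomial (h : DualEigenbasis H μ v w)
    (hμ : ∀ k, 0 < (μ k).re) {u : Space n → ℂ} {χ : ℂ} (hu : ContDiff ℝ ∞ u)
    (heq : ∀ ξ, linearFieldD H u ξ = χ * u ξ) :
    u ∈ Submodule.span ℂ {f | ∃ k, chiK μ k = χ ∧ f = coordMonomial v k} := by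
  obtain ⟨a, ha, haμ⟩ : ∃ a > 0, ∀ j, a ≤ (μ j).re := by
    cases isEmpty_or_nonempty (Fin n) with
    | inl _ => exact ⟨1, one_pos, fun j => isEmptyElim j⟩
    | inr _ =>
      obtain ⟨j, hj⟩ := Finite.exists_min fun j => (μ j).re
      exact ⟨_, hμ j, hj⟩
  -- Each derivative raises the real part of `χ` by at least `a`, so `N` bounds the number of
  -- derivatives before the solution is forced to vanish; the induction is on `N`.
  obtain ⟨N, hN⟩ : ∃ N : ℕ, 0 < χ.re + N * a := by
    obtain ⟨N, hN⟩ := exists_nat_gt (-χ.re / a)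
    rw [div_lt_iff₀ ha] at hN
    exact ⟨N, by linarith⟩
  have hle : (1 : ℕ∞ω) ≤ ∞ := one_le_two.trans two_le_smooth
  induction N generalizing u χ with
  | zero =>
    rw [h.eq_zero_of_re_pos hμ (hu.of_le hle) heq (by simpa using hN)]
    exact Submodule.zero_mem _
  | succ N ih =>
    have hDs : ∀ j, ContDiff ℝ ∞ (dirD (w j) u) := fun j => ContDiff.dirD hu (by simp) _
    by_cases hχ : χ = 0
    · have hconst : u = u 0 • coordMonomial v 0 := by
        ext ξ
        rw [h.eq_const_of_zero hμ (hu.of_le hle) (by simpa [hχ] using heq) ξ]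
        simp [coordMonomial]
      rw [hconst]
      exact Submodule.smul_mem _ _ (Submodule.subset_span ⟨0, by simp [chiK, hχ], rfl⟩)
    -- The Euler formula divided by `χ`. Multiplying a monomial for `χ + μ j` by `⟨v j, ξ⟩` gives
    -- one for `χ`.
    · have hrec : u = ∑ j, (-μ j / χ) • (coordAlong (v j) * dirD (w j) u) := by
        ext ξ
        have h1 := heq ξ
        rw [h.linearFieldD_eq] at h1
        have : u ξ = χ⁻¹ * (χ * u ξ) := by field_simp
        rw [this, ← h1, Finset.mul_sum]
        simp only [Finset.sum_apply, Pi.smul_apply, Pi.mul_apply, smul_eq_mul]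
        exact Finset.sum_congr rfl fun j _ => by ring
      rw [hrec]
      refine Submodule.sum_mem _ fun j _ => Submodule.smul_mem _ _ ?_
      have hj := ih (hDs j) (h.linearFieldD_dirD hu heq j) (by
        have := haμ j
        push_cast at hN
        simp only [Complex.add_re]
        linarith)
      generalize dirD (w j) u = g at hj
      induction hj using Submodule.span_induction with
      | mem f hf =>
        obtain ⟨k, hk, rfl⟩ := hf
        rw [coordAlong_mul_coordMonomial]
        exact Submodule.subset_span ⟨_, by rw [chiK_add_single, hk]; ring, rfl⟩
      | zero => simp
      | add f g _ _ hf hg => rw [mul_add]; exact Submodule.add_mem _ hf hg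
      | smul c f _ hf => rw [mul_smul_comm]; exact Submodule.smul_mem _ _ hf

/-- Monomials in independent coordinates are not identically zero. -/
lemma DualEigenbasis.coordMonomial_ne_zero (h : DualEigenbasis H μ v w) (k : Fin n → ℕ) :
    coordMonomial v k ≠ 0 := by
  let c : Fin n → Space n →ₗ[ℝ] ℂ := fun j =>
    { toFun := coordAlong (v j)
      map_add' := fun x y => by simp [coordAlong, mul_add, Finset.sum_add_distrib]
      map_smul' := fun r x => by
        simp only [coordAlong, PiLp.smul_apply, smul_eq_mul, Complex.ofReal_mul, RingHom.id_apply,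
          Complex.real_smul, Finset.mul_sum]
        exact Finset.sum_congr rfl fun i _ => by ring }
  -- A real vector space is not a finite union of proper subspaces, so some real point lies off the
  -- kernels of all the coordinates. The kernels are proper because `⟨w j, v j⟩ = 1`.
  obtain ⟨ξ, hξ⟩ := Submodule.exists_forall_notMem_of_forall_ne_top
    (fun j => LinearMap.ker (c j)) fun j hj => by
      have h0 : ∀ i, v j i = 0 := fun i => by
        have h1 : c j (EuclideanSpace.single i 1) = 0 := by
          rw [← LinearMap.mem_ker, hj]; trivial
        simpa [c, coordAlong, Pi.single_apply, apply_ite] using h1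
      have h2 := h.dual j j
      simp [dotProduct, h0] at h2
  intro h0
  have h1 : ∏ j, coordAlong (v j) ξ ^ k j = 0 := congrFun h0 ξ
  obtain ⟨j, -, hj⟩ := Finset.prod_eq_zero_iff.1 h1
  exact hξ j (LinearMap.mem_ker.2 (pow_eq_zero_iff (n := k j) (fun hk => by simp [hk] at hj) |>.1 hj))

end Homogeneous

/-! ### Plane waves and the Fourier transform of functions with moments. -/

section Fourier

variable {n : ℕ}

open FourierTransform

/-- The constant `2πi`. -/
def twoPiI : ℂ := 2 * Real.pi * Complex.I

lemma twoPiI_ne_zero : twoPiI ≠ 0 := Complex.two_pi_I_ne_zero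

/-- The plane wave `exp (-2πi ⟨ξ, s⟩)`. -/
def planeWave (ξ : Space n) : Space n → ℂ :=
  fun s => Complex.exp (-twoPiI * ∑ i, (ξ i : ℂ) * (s i : ℂ))

lemma contDiff_planeWave (ξ : Space n) : ContDiff ℝ ∞ (planeWave ξ) :=
  ContDiff.cexp (contDiff_const.mul (ContDiff.sum fun i _ => contDiff_const.mul (contDiff_coord i)))

lemma norm_planeWave (ξ s : Space n) : ‖planeWave ξ s‖ = 1 := by
  have : -twoPiI * ∑ i, (ξ i : ℂ) * (s i : ℂ) =
      ((-(2 * Real.pi * ∑ i, ξ i * s i) : ℝ) : ℂ) * Complex.I := by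
    rw [twoPiI]; push_cast; ring
  rw [planeWave, this, Complex.norm_exp_ofReal_mul_I]

lemma partialD_planeWave (ξ : Space n) (i : Fin n) :
    partialD i (planeWave ξ) = fun s => (-twoPiI * (ξ i : ℂ)) * planeWave ξ s := by
  ext s
  unfold planeWave
  rw [partialD_cexp _ (by fun_prop), partialD_const_mul _ _ (by fun_prop)]
  congr 2
  rw [partialD_sum _ _ (by fun_prop)]
  have : ∀ j, partialD i (fun t : Space n => (ξ j : ℂ) * (t j : ℂ)) s =
      (ξ j : ℂ) * if j = i then 1 else 0 := fun j => by
    rw [partialD_const_mul _ _ (by fun_prop), partialD_coord]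
  rw [Finset.sum_congr rfl fun j _ => this j]
  simp

lemma fourier_eq_integral_planeWave (f : Space n → ℂ) (ξ : Space n) :
    𝓕 f ξ = ∫ s, f s * planeWave ξ s := by
  rw [Real.fourier_eq']
  refine integral_congr_ae (Filter.Eventually.of_forall fun s => ?_)
  simp only [smul_eq_mul]
  rw [mul_comm, planeWave, twoPiI]
  congr 2
  simp only [PiLp.inner_apply, RCLike.inner_apply, conj_trivial]
  push_cast
  ring

lemma HasAllMoments.integrable_norm {f : Space n → ℂ} (hf : HasAllMoments f) (m : ℕ) :
    Integrable fun s => ‖s‖ ^ m * ‖f s‖ := by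
  have := (hf m).norm
  simpa using this

lemma HasAllMoments.integrable {f : Space n → ℂ} (hf : HasAllMoments f) : Integrable f := by
  have := hf 0
  simpa using this

/-- A function of at most linear growth is integrable against a function with moments. -/
lemma HasAllMoments.integrable_mul {f : Space n → ℂ} (hf : HasAllMoments f) {g : Space n → ℂ}
    (hg : Continuous g) {C : ℝ} (hb : ∀ s, ‖g s‖ ≤ C * (1 + ‖s‖)) :
    Integrable fun s => f s * g s := by
  have h1 := ((hf.integrable_norm 0).add (hf.integrable_norm 1)).const_mul C
  refine h1.mono' (hf.integrable.aestronglyMeasurable.mul hg.aestronglyMeasurable)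
    (Filter.Eventually.of_forall fun s => ?_)
  rw [norm_mul]
  calc _ ≤ ‖f s‖ * (C * (1 + ‖s‖)) := by gcongr; exact hb s
    _ = _ := by simp; ring

/-- Each derivative of the transform costs one moment. This smoothness is what excludes
non-polynomial solutions of the first-order equation. -/
lemma HasAllMoments.contDiff_fourier {f : Space n → ℂ} (hf : HasAllMoments f) :
    ContDiff ℝ ∞ (𝓕 f) :=
  Real.contDiff_fourier (N := ⊤) fun m _ => hf.integrable_norm m

lemma HasAllMoments.partialD_fourier {f : Space n → ℂ} (hf : HasAllMoments f) (i : Fin n)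
    (ξ : Space n) :
    partialD i (𝓕 f) ξ = ∫ s, f s * ((-twoPiI * (s i : ℂ)) * planeWave ξ s) := by
  have h1 : Integrable fun s => ‖s‖ * ‖f s‖ := by simpa using hf.integrable_norm 1
  have h2 : Integrable (VectorFourier.fourierSMulRight (innerSL ℝ) f) := by
    refine (h1.const_mul (2 * Real.pi * ‖(innerSL ℝ : Space n →L[ℝ] Space n →L[ℝ] ℝ)‖)).mono'
      (hf.integrable.aestronglyMeasurable.fourierSMulRight)
      (Filter.Eventually.of_forall fun s => ?_)
    refine (VectorFourier.norm_fourierSMulRight_le _ _ _).trans (le_of_eq (by ring))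
  rw [partialD, Real.fderiv_fourier hf.integrable h1,
    Real.fourier_continuousLinearMap_apply h2, fourier_eq_integral_planeWave]
  refine integral_congr_ae (Filter.Eventually.of_forall fun s => ?_)
  simp only [VectorFourier.fourierSMulRight_apply, twoPiI]
  have : innerSL ℝ s (EuclideanSpace.single i 1) = s i := by
    rw [innerSL_apply_apply]
    simp [EuclideanSpace.inner_single_right]
  rw [this]
  simp
  ring

/-- The Fourier transform is injective on integrable functions. -/
lemma ae_eq_zero_of_fourier_eq_zero {f : Space n → ℂ} (hf : Integrable f)
    (h : ∀ ξ, 𝓕 f ξ = 0) : f =ᵐ[volume] 0 := by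
  refine ae_eq_zero_of_integral_contDiff_smul_eq_zero hf.locallyIntegrable fun g hg hgc => ?_
  have hg₁ : HasCompactSupport (Complex.ofRealCLM ∘ g) := hgc.comp_left rfl
  have hg₂ : ContDiff ℝ ∞ (Complex.ofRealCLM ∘ g) := by fun_prop
  set G : SchwartzMap (Space n) ℂ := hg₁.toSchwartzMap hg₂ with hG
  -- The test function is itself a Fourier transform, so its pairing with `f` can be moved to the
  -- pairing of `g'` with `𝓕 f = 0`.
  set g' : SchwartzMap (Space n) ℂ := 𝓕⁻ G with hg'
  have hG' : 𝓕 (g' : Space n → ℂ) = G := by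
    rw [← SchwartzMap.fourier_coe, hg', FourierTransform.fourier_fourierInv_eq]
  have h1 : ∫ ξ, 𝓕 f ξ • g' ξ = ∫ s, f s • 𝓕 (g' : Space n → ℂ) s :=
    VectorFourier.integral_bilin_fourierIntegral_eq_flip
      (ContinuousLinearMap.lsmul ℂ ℂ) (L := innerₗ (Space n)) Real.continuous_fourierChar
      continuous_inner hf (SchwartzMap.integrable (μ := volume) g') |>.trans <| by
        rw [flip_innerₗ]; rfl
  rw [hG'] at h1
  simp only [h, zero_smul, integral_zero] at h1
  rw [h1]
  refine integral_congr_ae (Filter.Eventually.of_forall fun s => ?_)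
  simp [hG, mul_comm]

end Fourier

/-! ### Smooth cutoffs with uniform bounds on two derivatives. -/

section Cutoff

variable {n : ℕ}

/-- `f` and its partial derivatives of order at most two are bounded by `K`. -/
structure BoundedTwo (K : ℝ) (f : Space n → ℂ) : Prop where
  smooth : ContDiff ℝ ∞ f
  zero : ∀ s, ‖f s‖ ≤ K
  one : ∀ i s, ‖partialD i f s‖ ≤ K
  two : ∀ i j s, ‖partialD i (partialD j f) s‖ ≤ K

/-- The factor `4` counts the terms in the Leibniz rule for a second derivative. -/
lemma BoundedTwo.mul {K L : ℝ} {f g : Space n → ℂ} (hf : BoundedTwo K f) (hg : BoundedTwo L g) :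
    BoundedTwo (4 * (K * L)) (fun s => f s * g s) := by
  have hK : 0 ≤ K := (norm_nonneg _).trans (hf.zero 0)
  have hL : 0 ≤ L := (norm_nonneg _).trans (hg.zero 0)
  have hKL := mul_nonneg hK hL
  have hm : ∀ {a b : ℂ}, ‖a‖ ≤ K → ‖b‖ ≤ L → ‖a * b‖ ≤ K * L := fun ha hb => by
    rw [norm_mul]; exact mul_le_mul ha hb (norm_nonneg _) hK
  have hd : ∀ {u : Space n → ℂ}, ContDiff ℝ ∞ u → Differentiable ℝ u := fun hu =>
    hu.differentiable (by simp)
  have hd1 : ∀ {u : Space n → ℂ}, ContDiff ℝ ∞ u → ∀ j, Differentiable ℝ (partialD j u) :=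
    fun hu j => (ContDiff.partialD (m := ∞) hu (by simp) j).differentiable (by simp)
  have e1 : ∀ j, partialD j (fun s => f s * g s) =
      fun s => partialD j f s * g s + f s * partialD j g s := fun j => funext fun s =>
    partialD_mul j (hd hf.smooth s) (hd hg.smooth s)
  refine ⟨hf.smooth.mul hg.smooth, fun s => ?_, fun i s => ?_, fun i j s => ?_⟩
  · linarith [hm (hf.zero s) (hg.zero s)]
  · rw [e1]
    have := norm_add_le (partialD i f s * g s) (f s * partialD i g s)
    linarith [hm (hf.one i s) (hg.zero s), hm (hf.zero s) (hg.one i s)]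
  · have a1 := hd hf.smooth
    have a2 := hd hg.smooth
    have a3 := hd1 hf.smooth j
    have a4 := hd1 hg.smooth j
    rw [e1, partialD_add _ (by fun_prop) (by fun_prop),
      partialD_mul _ (a3 s) (a2 s), partialD_mul _ (a1 s) (a4 s)]
    have b1 := norm_add_le (partialD i (partialD j f) s * g s) (partialD j f s * partialD i g s)
    have b2 := norm_add_le (partialD i f s * partialD j g s) (f s * partialD i (partialD j g) s)
    refine (norm_add_le _ _).trans ?_
    linarith [hm (hf.two i j s) (hg.zero s), hm (hf.one j s) (hg.one i s),
      hm (hf.one i s) (hg.one j s), hm (hf.zero s) (hg.two i j s)]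

lemma exists_boundedTwo_planeWave (ξ : Space n) : ∃ K, BoundedTwo K (planeWave ξ) := by
  have hle : ∀ i, ‖-twoPiI * (ξ i : ℂ)‖ ≤ ‖twoPiI‖ * ‖ξ‖ := fun i => by
    rw [norm_mul, norm_neg, Complex.norm_real]
    gcongr
    exact PiLp.norm_apply_le ξ i
  set c := ‖twoPiI‖ * ‖ξ‖ with hc
  have hc0 : 0 ≤ c := by positivity
  refine ⟨1 + c + c * c, contDiff_planeWave ξ, fun s => ?_, fun i s => ?_, fun i j s => ?_⟩
  · rw [norm_planeWave]; nlinarith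
  · rw [partialD_planeWave, norm_mul, norm_planeWave]; nlinarith [hle i]
  · rw [partialD_planeWave, partialD_const_mul _ _
      ((contDiff_planeWave ξ).differentiable (by simp) s), partialD_planeWave]
    simp only [norm_mul _ (_ * planeWave ξ s), norm_mul _ (planeWave ξ s), norm_planeWave, mul_one]
    have := mul_le_mul (hle j) (hle i) (norm_nonneg _) hc0
    nlinarith

lemma partialD_comp_smul {f : Space n → ℂ} (hf : Differentiable ℝ f) (c : ℝ) (i : Fin n) :
    partialD i (fun s => f (c • s)) = fun s => (c : ℂ) * partialD i f (c • s) := by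
  ext s
  have h1 : HasFDerivAt (fun s : Space n => c • s) (c • ContinuousLinearMap.id ℝ (Space n)) s :=
    (hasFDerivAt_id s).const_smul c
  have h2 := (hf (c • s)).hasFDerivAt.comp s h1
  have h3 : fderiv ℝ (fun s => f (c • s)) s = _ := h2.fderiv
  rw [partialD, h3]
  simp [partialD]

/-- Smooth cutoff functions that exhaust the space, with uniformly bounded derivatives. -/
lemma exists_cutoff : ∃ (K : ℝ) (η : ℕ → Space n → ℂ), (∀ N, BoundedTwo K (η N)) ∧
    (∀ N, HasCompactSupport (η N)) ∧ ∀ s, ∀ᶠ N in Filter.atTop, η N =ᶠ[nhds s] fun _ => 1 := by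
  let b : ContDiffBump (0 : Space n) := ⟨1, 2, one_pos, one_lt_two⟩
  set f : Space n → ℂ := fun s => (b s : ℂ) with hf
  have hfs : ContDiff ℝ ∞ f := Complex.ofRealCLM.contDiff.comp b.contDiff
  have hfc : HasCompactSupport f := b.hasCompactSupport.comp_left (g := fun x : ℝ => (x : ℂ)) rfl
  have hc1 : ∀ j, HasCompactSupport (partialD j f) := fun j => hfc.fderiv_apply (𝕜 := ℝ) _
  have hc2 : ∀ i j, HasCompactSupport (partialD i (partialD j f)) := fun i j =>
    (hc1 j).fderiv_apply (𝕜 := ℝ) _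
  have hs1 : ∀ j, ContDiff ℝ ∞ (partialD j f) := fun j => ContDiff.partialD hfs (by simp) j
  have hs2 : ∀ i j, ContDiff ℝ ∞ (partialD i (partialD j f)) := fun i j =>
    ContDiff.partialD (hs1 j) (by simp) i
  have hbd : ∀ {u : Space n → ℂ}, HasCompactSupport u → ContDiff ℝ ∞ u →
      ∃ C, 0 ≤ C ∧ ∀ s, ‖u s‖ ≤ C := fun hu hu' => by
    obtain ⟨C, hC⟩ := hu.exists_bound_of_continuous hu'.continuous
    exact ⟨C, (norm_nonneg _).trans (hC 0), hC⟩
  obtain ⟨C0, hC0, h0⟩ := hbd hfc hfs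
  choose C1 hC1 h1 using fun j => hbd (hc1 j) (hs1 j)
  choose C2 hC2 h2 using fun i j => hbd (hc2 i j) (hs2 i j)
  set K := C0 + ∑ j, C1 j + ∑ i, ∑ j, C2 i j with hK
  have hS1 : 0 ≤ ∑ j, C1 j := Finset.sum_nonneg fun j _ => hC1 j
  have hS2 : 0 ≤ ∑ i, ∑ j, C2 i j :=
    Finset.sum_nonneg fun i _ => Finset.sum_nonneg fun j _ => hC2 i j
  have k1 : ∀ j s, ‖partialD j f s‖ ≤ K := fun j s => by
    have := Finset.single_le_sum (fun j _ => hC1 j) (Finset.mem_univ j)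
    linarith [h1 j s]
  have k2 : ∀ i j s, ‖partialD i (partialD j f) s‖ ≤ K := fun i j s => by
    have a1 := Finset.single_le_sum (f := fun j => C2 i j) (fun j _ => hC2 i j) (Finset.mem_univ j)
    have a2 := Finset.single_le_sum (f := fun i => ∑ j, C2 i j)
      (fun i _ => Finset.sum_nonneg fun j _ => hC2 i j) (Finset.mem_univ i)
    linarith [h2 i j s]
  -- Dilating one bump function by factors at most `1` does not increase its derivatives, so the
  -- same `K` serves all cutoffs; the `N`-th is `1` on the ball of radius `N + 1`.
  set c : ℕ → ℝ := fun N => ((N : ℝ) + 1)⁻¹ with hc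
  have hcpos : ∀ N, 0 < c N := fun N => by positivity
  have hcle : ∀ N, ‖(c N : ℂ)‖ ≤ 1 := fun N => by
    rw [Complex.norm_real, Real.norm_of_nonneg (hcpos N).le]
    exact inv_le_one_of_one_le₀ (by linarith [Nat.cast_nonneg (α := ℝ) N])
  have hsmul : ∀ N, ContDiff ℝ ∞ fun s : Space n => c N • s := fun N => contDiff_const_smul _
  have hle1 : ∀ {a z : ℂ}, ‖a‖ ≤ 1 → ‖z‖ ≤ K → ‖a * z‖ ≤ K := fun ha hz => by
    rw [norm_mul]
    exact (mul_le_of_le_one_left (norm_nonneg _) ha).trans hz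
  have e1 : ∀ N j, partialD j (fun s => f (c N • s)) = fun s => (c N : ℂ) * partialD j f (c N • s) :=
    fun N j => partialD_comp_smul (hfs.differentiable (by simp)) _ j
  refine ⟨K, fun N s => f (c N • s), fun N => ⟨hfs.comp (hsmul N), fun s => ?_, fun j s => ?_,
    fun i j s => ?_⟩, fun N => ?_, fun s => ?_⟩
  · linarith [h0 (c N • s)]
  · rw [e1]
    exact hle1 (hcle N) (k1 j _)
  · have hd : Differentiable ℝ fun s => partialD j f (c N • s) :=
      ((hs1 j).comp (hsmul N)).differentiable (by simp)
    rw [e1, partialD_const_mul _ _ (hd s),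
      partialD_comp_smul ((hs1 j).differentiable (by simp))]
    exact hle1 (hcle N) (hle1 (hcle N) (k2 i j _))
  · exact hfc.comp_smul (hcpos N).ne'
  · obtain ⟨M, hM⟩ := exists_nat_gt ‖s‖
    filter_upwards [Filter.eventually_ge_atTop M] with N hN
    have hopen : ∀ᶠ t in nhds s, ‖t‖ < (N : ℝ) + 1 := by
      refine (continuous_norm.tendsto s).eventually (gt_mem_nhds ?_)
      have : (M : ℝ) ≤ N := by exact_mod_cast hN
      linarith
    filter_upwards [hopen] with t ht
    have : b (c N • t) = 1 := by
      apply b.one_of_mem_closedBall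
      rw [mem_closedBall_zero_iff, norm_smul, Real.norm_of_nonneg (hcpos N).le]
      change ((N : ℝ) + 1)⁻¹ * ‖t‖ ≤ 1
      rw [inv_mul_le_iff₀ (by positivity)]
      linarith
    simp [hf, this]

end Cutoff

/-! ### Weak solutions, their equation on the Fourier side, and the transforms of the `Φ_k`. -/

section Adjoint

variable {n : ℕ}

/-- The adjoint of the Fokker–Planck operator in non-divergence form. -/
lemma fokkerPlanckAdjoint_eq (B H : Matrix (Fin n) (Fin n) ℝ) {f : Space n → ℂ}
    (hf : ContDiff ℝ 2 f) (s : Space n) :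
    fokkerPlanckAdjoint B H f s = (1 / 2 : ℂ) * ∑ i, ∑ j, (B i j : ℂ) * partialD i (partialD j f) s
      + ∑ i, ∑ j, (H i j : ℂ) * (s j : ℂ) * partialD i f s := by
  have hd' : ∀ j, Differentiable ℝ (partialD j f) := fun j =>
    (ContDiff.partialD (m := 1) hf (by norm_num) j).differentiable one_ne_zero
  simp only [fokkerPlanckAdjoint, divergence]
  congr 1
  · congr 1
    refine Finset.sum_congr rfl fun i _ => ?_
    rw [partialD_sum]
    · exact Finset.sum_congr rfl fun j _ => partialD_const_mul _ _ (hd' j s)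
    · exact fun j _ => ((hd' j s).const_mul _)
  · exact Finset.sum_congr rfl fun i _ => Finset.sum_mul _ _ _

lemma continuous_fokkerPlanckAdjoint (B H : Matrix (Fin n) (Fin n) ℝ) {f : Space n → ℂ}
    (hf : ContDiff ℝ 2 f) : Continuous (fokkerPlanckAdjoint B H f) := by
  have h1 : ∀ j, ContDiff ℝ 1 (partialD j f) := fun j =>
    ContDiff.partialD hf (by norm_num) j
  have h0 : ∀ i j, Continuous (partialD i (partialD j f)) := fun i j =>
    (ContDiff.partialD (m := 0) (h1 j) (by norm_num) i).continuous
  have hc : ∀ j, Continuous (partialD j f) := fun j => (h1 j).continuous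
  have hx : ∀ j : Fin n, Continuous fun s : Space n => (s j : ℂ) := fun j =>
    (differentiable_coord j).continuous
  rw [show fokkerPlanckAdjoint B H f = _ from funext (fokkerPlanckAdjoint_eq B H hf)]
  refine (continuous_const.mul ?_).add ?_
  · exact continuous_finsetSum _ fun i _ => continuous_finsetSum _ fun j _ =>
      continuous_const.mul (h0 i j)
  · exact continuous_finsetSum _ fun i _ => continuous_finsetSum _ fun j _ =>
      (continuous_const.mul (hx j)).mul (hc i)

lemma fokkerPlanckAdjoint_congr (B H : Matrix (Fin n) (Fin n) ℝ) {f g : Space n → ℂ} {s : Space n}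
    (h : f =ᶠ[nhds s] g) : fokkerPlanckAdjoint B H f s = fokkerPlanckAdjoint B H g s := by
  have h1 : ∀ j, partialD j f =ᶠ[nhds s] partialD j g := fun j => by
    filter_upwards [h.eventuallyEq_nhds] with t ht using partialD_congr j ht
  simp only [fokkerPlanckAdjoint, divergence]
  congr 1
  · congr 1
    refine Finset.sum_congr rfl fun i _ => partialD_congr i ?_
    have : ∀ᶠ t in nhds s, ∀ j, partialD j f t = partialD j g t :=
      Filter.eventually_all.2 h1
    filter_upwards [this] with t ht
    simp [ht]
  · exact Finset.sum_congr rfl fun i _ => by rw [(h1 i).eq_of_nhds]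

/-- The diffusion coefficients are constant and the drift is linear, so the growth is linear,
uniformly in `f`. Hence the moments of orders `0` and `1` give a dominating function. -/
lemma exists_fokkerPlanckAdjoint_bound (B H : Matrix (Fin n) (Fin n) ℝ) (K : ℝ) :
    ∃ C, ∀ f : Space n → ℂ, BoundedTwo K f → ∀ s,
      ‖fokkerPlanckAdjoint B H f s‖ ≤ C * (1 + ‖s‖) := by
  refine ⟨(∑ i, ∑ j, ‖B i j‖) * K + (∑ i, ∑ j, ‖H i j‖) * K, fun f hf s => ?_⟩
  have hK : 0 ≤ K := (norm_nonneg _).trans (hf.zero 0)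
  have hs := norm_nonneg s
  rw [fokkerPlanckAdjoint_eq B H (hf.smooth.of_le two_le_smooth)]
  have h1 : ‖∑ i, ∑ j, (B i j : ℂ) * partialD i (partialD j f) s‖ ≤ (∑ i, ∑ j, ‖B i j‖) * K := by
    rw [Finset.sum_mul]
    refine (norm_sum_le _ _).trans (Finset.sum_le_sum fun i _ => ?_)
    rw [Finset.sum_mul]
    refine (norm_sum_le _ _).trans (Finset.sum_le_sum fun j _ => ?_)
    rw [norm_mul, Complex.norm_real]
    gcongr
    exact hf.two i j s
  have h2 : ‖∑ i, ∑ j, (H i j : ℂ) * (s j : ℂ) * partialD i f s‖ ≤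
      (∑ i, ∑ j, ‖H i j‖) * K * ‖s‖ := by
    rw [Finset.sum_mul, Finset.sum_mul]
    refine (norm_sum_le _ _).trans (Finset.sum_le_sum fun i _ => ?_)
    rw [Finset.sum_mul, Finset.sum_mul]
    refine (norm_sum_le _ _).trans (Finset.sum_le_sum fun j _ => ?_)
    rw [norm_mul, norm_mul, Complex.norm_real, Complex.norm_real]
    have a1 : ‖s j‖ ≤ ‖s‖ := PiLp.norm_apply_le s j
    calc _ ≤ ‖H i j‖ * ‖s‖ * K := by gcongr; exact hf.one i s
      _ = _ := by ring
  have hB : 0 ≤ (∑ i, ∑ j, ‖B i j‖) * K := by positivity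
  have hH : 0 ≤ (∑ i, ∑ j, ‖H i j‖) * K := by positivity
  refine (norm_add_le _ _).trans ?_
  rw [norm_mul]
  have h3 : ‖(1 / 2 : ℂ)‖ ≤ 1 := by norm_num
  have h4 := mul_le_of_le_one_left
    (norm_nonneg (∑ i, ∑ j, (B i j : ℂ) * partialD i (partialD j f) s)) h3
  nlinarith

/-- Weak solutions can be tested against plane waves. -/
lemma IsWeakSolution.integral_planeWave {B H : Matrix (Fin n) (Fin n) ℝ} {χ : ℂ}
    {φ : Space n → ℂ} (h : IsWeakSolution B H χ φ) (ξ : Space n) :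
    ∫ s, φ s * fokkerPlanckAdjoint B H (planeWave ξ) s = χ * ∫ s, φ s * planeWave ξ s := by
  obtain ⟨K, η, hη, hηc, hη1⟩ := exists_cutoff (n := n)
  obtain ⟨L, hL⟩ := exists_boundedTwo_planeWave ξ
  set ψ : ℕ → Space n → ℂ := fun N s => η N s * planeWave ξ s with hψ
  have hψb : ∀ N, BoundedTwo (4 * (K * L)) (ψ N) := fun N => (hη N).mul hL
  have hψc : ∀ N, HasCompactSupport (ψ N) := fun N => (hηc N).mul_right
  have hψ1 : ∀ s, ∀ᶠ N in Filter.atTop, ψ N =ᶠ[nhds s] planeWave ξ := fun s => by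
    filter_upwards [hη1 s] with N hN
    filter_upwards [hN] with t ht
    simp [hψ, ht]
  obtain ⟨C, hC⟩ := exists_fokkerPlanckAdjoint_bound B H (4 * (K * L))
  have hm := h.moments
  have hφ := hm.integrable
  have l1 : Filter.Tendsto (fun N => ∫ s, φ s * fokkerPlanckAdjoint B H (ψ N) s) Filter.atTop
      (nhds (∫ s, φ s * fokkerPlanckAdjoint B H (planeWave ξ) s)) := by
    -- At each point the integrand is eventually constant in `N`, because the cutoff is `1` on a
    -- whole neighbourhood and so does not affect derivatives there.
    refine tendsto_integral_of_dominated_convergence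
      (fun s => C * (‖s‖ ^ 0 * ‖φ s‖ + ‖s‖ ^ 1 * ‖φ s‖)) (fun N => ?_) ?_ (fun N => ?_) ?_
    · exact hφ.aestronglyMeasurable.mul (continuous_fokkerPlanckAdjoint B H
        ((hψb N).smooth.of_le two_le_smooth)).aestronglyMeasurable
    · exact ((hm.integrable_norm 0).add (hm.integrable_norm 1)).const_mul C
    · refine Filter.Eventually.of_forall fun s => ?_
      rw [norm_mul]
      calc _ ≤ ‖φ s‖ * (C * (1 + ‖s‖)) := by gcongr; exact hC _ (hψb N) s
        _ = _ := by ring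
    · refine Filter.Eventually.of_forall fun s => ?_
      refine Filter.Tendsto.congr' ?_ tendsto_const_nhds
      filter_upwards [hψ1 s] with N hN
      rw [fokkerPlanckAdjoint_congr B H hN]
  have l2 : Filter.Tendsto (fun N => χ * ∫ s, φ s * ψ N s) Filter.atTop
      (nhds (χ * ∫ s, φ s * planeWave ξ s)) := by
    refine Filter.Tendsto.const_mul _ (tendsto_integral_of_dominated_convergence
      (fun s => ‖φ s‖ * (4 * (K * L))) (fun N => ?_) ?_ (fun N => ?_) ?_)
    · exact hφ.aestronglyMeasurable.mul (hψb N).smooth.continuous.aestronglyMeasurable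
    · exact hφ.norm.mul_const _
    · refine Filter.Eventually.of_forall fun s => ?_
      rw [norm_mul]
      gcongr
      exact (hψb N).zero s
    · refine Filter.Eventually.of_forall fun s => ?_
      refine Filter.Tendsto.congr' ?_ tendsto_const_nhds
      filter_upwards [hψ1 s] with N hN
      rw [hN.eq_of_nhds]
  refine tendsto_nhds_unique l1 (l2.congr fun N => ?_)
  exact (h.eigen (ψ N) (hψb N).smooth (hψc N)).symm

open FourierTransform

/-- The eigenvalue equation on the Fourier side. -/
lemma IsWeakSolution.linearFieldD_fourier {B H : Matrix (Fin n) (Fin n) ℝ} {χ : ℂ}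
    {φ : Space n → ℂ} (h : IsWeakSolution B H χ φ) (ξ : Space n) :
    linearFieldD H (𝓕 φ) ξ = (χ - (1 / 2 : ℂ) * twoPiI ^ 2 *
      ∑ i, ∑ j, (B i j : ℂ) * (ξ i : ℂ) * (ξ j : ℂ)) * 𝓕 φ ξ := by
  have h1 := h.integral_planeWave ξ
  have hm := h.moments
  have hw := contDiff_planeWave ξ
  have hi0 : Integrable fun s => φ s * planeWave ξ s :=
    hm.integrable_mul hw.continuous (C := 1) fun s => by
      rw [norm_planeWave]; linarith [norm_nonneg s]
  have hi1 : ∀ i, Integrable fun s => φ s * ((-twoPiI * (s i : ℂ)) * planeWave ξ s) := fun i => by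
    refine hm.integrable_mul (C := ‖twoPiI‖) ?_ fun s => ?_
    · exact (continuous_const.mul (differentiable_coord i).continuous).mul hw.continuous
    · rw [norm_mul, norm_planeWave, norm_mul, norm_neg, mul_one, Complex.norm_real]
      have : ‖s i‖ ≤ ‖s‖ := PiLp.norm_apply_le s i
      gcongr
      linarith
  -- On a plane wave, diffusion acts as multiplication by a quadratic form in `ξ`, and each factor
  -- `s i` in the drift becomes `∂/∂ξ_i` of the transform after integration.
  have e : ∀ s, φ s * fokkerPlanckAdjoint B H (planeWave ξ) s =
      (1 / 2 : ℂ) * twoPiI ^ 2 * (∑ i, ∑ j, (B i j : ℂ) * (ξ i : ℂ) * (ξ j : ℂ)) *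
        (φ s * planeWave ξ s) +
      ∑ i, ∑ j, (H j i : ℂ) * (ξ j : ℂ) * (φ s * ((-twoPiI * (s i : ℂ)) * planeWave ξ s)) := by
    intro s
    have a2 : ∀ i j, partialD i (partialD j (planeWave ξ)) s =
        twoPiI ^ 2 * ((ξ i : ℂ) * (ξ j : ℂ)) * planeWave ξ s := fun i j => by
      rw [partialD_planeWave, partialD_const_mul _ _ (hw.differentiable (by simp) s),
        partialD_planeWave]
      ring
    rw [fokkerPlanckAdjoint_eq B H (hw.of_le two_le_smooth)]
    simp only [a2]
    simp only [partialD_planeWave]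
    rw [mul_add]
    congr 1
    · simp only [Finset.mul_sum, Finset.sum_mul]
      exact Finset.sum_congr rfl fun i _ => Finset.sum_congr rfl fun j _ => by ring
    · rw [Finset.sum_comm]
      simp only [Finset.mul_sum]
      exact Finset.sum_congr rfl fun i _ => Finset.sum_congr rfl fun j _ => by ring
  simp only [e] at h1
  rw [integral_add (hi0.const_mul _) (integrable_finsetSum _ fun i _ =>
    integrable_finsetSum _ fun j _ => (hi1 i).const_mul _), integral_const_mul,
    integral_finsetSum _ (fun i _ => integrable_finsetSum _ fun j _ => (hi1 i).const_mul _)] at h1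
  have e2 : ∀ i, ∫ s, ∑ j, (H j i : ℂ) * (ξ j : ℂ) *
      (φ s * ((-twoPiI * (s i : ℂ)) * planeWave ξ s)) =
      ∑ j, (H j i : ℂ) * (ξ j : ℂ) * partialD i (𝓕 φ) ξ := fun i => by
    rw [integral_finsetSum _ fun j _ => (hi1 i).const_mul _]
    refine Finset.sum_congr rfl fun j _ => ?_
    rw [integral_const_mul, hm.partialD_fourier]
  simp only [e2] at h1
  rw [← fourier_eq_integral_planeWave] at h1
  rw [linearFieldD, sub_mul, ← h1]
  ring

lemma linearFieldD_mul (H : Matrix (Fin n) (Fin n) ℝ) {f g : Space n → ℂ} {ξ : Space n}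
    (hf : DifferentiableAt ℝ f ξ) (hg : DifferentiableAt ℝ g ξ) :
    linearFieldD H (fun t => f t * g t) ξ = linearFieldD H f ξ * g ξ + f ξ * linearFieldD H g ξ := by
  simp only [linearFieldD, partialD_mul _ hf hg, mul_add, Finset.sum_add_distrib, Finset.sum_mul,
    Finset.mul_sum]
  congr 1 <;> exact Finset.sum_congr rfl fun i _ => Finset.sum_congr rfl fun j _ => by ring

/-- The derivative of the inverse characteristic function of the stationary law. -/
lemma linearFieldD_gaussian {B H Γ : Matrix (Fin n) (Fin n) ℝ} (hL : H * Γ + Γ * Hᵀ = -B)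
    (hΓ : Γᵀ = Γ) (c : ℝ) (ξ : Space n) :
    linearFieldD H (gaussian (c • Γ)) ξ = (1 / 2 : ℂ) * c *
      (∑ i, ∑ j, (B i j : ℂ) * (ξ i : ℂ) * (ξ j : ℂ)) * gaussian (c • Γ) ξ := by
  set x : Fin n → ℝ := fun i => ξ i with hx
  have hS : (c • Γ)ᵀ = c • Γ := by rw [Matrix.transpose_smul, hΓ]
  have e1 : x ⬝ᵥ (B *ᵥ x) = -(2 * ((Hᵀ *ᵥ x) ⬝ᵥ (Γ *ᵥ x))) := by
    have hB : B = -(H * Γ + Γ * Hᵀ) := by rw [hL]; simp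
    have a1 : x ⬝ᵥ ((H * Γ) *ᵥ x) = (Hᵀ *ᵥ x) ⬝ᵥ (Γ *ᵥ x) := by
      rw [← Matrix.mulVec_mulVec, Matrix.dotProduct_mulVec x H, Matrix.mulVec_transpose]
    have a2 : x ⬝ᵥ ((Γ * Hᵀ) *ᵥ x) = (Hᵀ *ᵥ x) ⬝ᵥ (Γ *ᵥ x) := by
      rw [← Matrix.mulVec_mulVec, Matrix.dotProduct_mulVec x Γ, ← Matrix.mulVec_transpose, hΓ,
        dotProduct_comm]
    rw [hB, Matrix.neg_mulVec, dotProduct_neg, Matrix.add_mulVec, dotProduct_add, a1, a2]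
    ring
  have e2 : ∑ i, ∑ j, (B i j : ℂ) * (ξ i : ℂ) * (ξ j : ℂ) = ((x ⬝ᵥ (B *ᵥ x) : ℝ) : ℂ) := by
    simp only [dotProduct, Matrix.mulVec, Finset.mul_sum, hx]
    push_cast
    exact Finset.sum_congr rfl fun i _ => Finset.sum_congr rfl fun j _ => by ring
  have e3 : linearFieldD H (gaussian (c • Γ)) ξ =
      -(c : ℂ) * (((Hᵀ *ᵥ x) ⬝ᵥ (Γ *ᵥ x) : ℝ) : ℂ) * gaussian (c • Γ) ξ := by
    simp only [linearFieldD, partialD_gaussian hS, dotProduct, Matrix.mulVec, hx,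
      Matrix.smul_apply, smul_eq_mul, Matrix.transpose_apply]
    push_cast
    rw [Finset.mul_sum, Finset.sum_mul]
    refine Finset.sum_congr rfl fun i _ => ?_
    simp only [mul_assoc (c : ℂ), ← Finset.mul_sum, ← Finset.sum_mul]
    ring
  rw [e2, e1, e3]
  push_cast
  ring

/-- The inverse characteristic function of the Gaussian law with covariance matrix `Γ`. -/
def invCharFun (Γ : Matrix (Fin n) (Fin n) ℝ) : Space n → ℂ := gaussian ((-(4 * Real.pi ^ 2)) • Γ)

lemma contDiff_invCharFun (Γ : Matrix (Fin n) (Fin n) ℝ) : ContDiff ℝ ∞ (invCharFun Γ) :=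
  contDiff_gaussian _

lemma invCharFun_ne_zero (Γ : Matrix (Fin n) (Fin n) ℝ) (ξ : Space n) : invCharFun Γ ξ ≠ 0 :=
  Complex.exp_ne_zero _

/-- `invCharFun Γ` is an integrating factor: the quadratic term it produces through the Lyapunov
equation is the negative of the diffusion term, since `(2πi)² = -4π²` is the scale in its exponent.
-/
lemma IsWeakSolution.linearFieldD_invCharFun_mul {B H Γ : Matrix (Fin n) (Fin n) ℝ} {χ : ℂ}
    {φ : Space n → ℂ} (h : IsWeakSolution B H χ φ) (hL : H * Γ + Γ * Hᵀ = -B) (hΓ : Γᵀ = Γ)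
    (ξ : Space n) :
    linearFieldD H (fun ξ => invCharFun Γ ξ * 𝓕 φ ξ) ξ = χ * (invCharFun Γ ξ * 𝓕 φ ξ) := by
  rw [linearFieldD_mul H ((contDiff_invCharFun Γ).differentiable (by simp) ξ)
    (h.moments.contDiff_fourier.differentiable (by simp) ξ), h.linearFieldD_fourier, invCharFun,
    linearFieldD_gaussian hL hΓ]
  have : twoPiI ^ 2 = ((-(4 * Real.pi ^ 2) : ℝ) : ℂ) := by
    rw [twoPiI, mul_pow, Complex.I_sq]; push_cast; ring
  rw [this]
  ring

/-- The Fourier transform of a weak solution is a polynomial times a Gaussian. -/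
lemma IsWeakSolution.mem_span {B H Γ : Matrix (Fin n) (Fin n) ℝ} {μ : Fin n → ℂ}
    {v w : Fin n → Fin n → ℂ} (hvw : DualEigenbasis H μ v w) (hμ : ∀ k, 0 < (μ k).re) {χ : ℂ}
    {φ : Space n → ℂ} (h : IsWeakSolution B H χ φ) (hL : H * Γ + Γ * Hᵀ = -B) (hΓ : Γᵀ = Γ) :
    (fun ξ => invCharFun Γ ξ * 𝓕 φ ξ) ∈
      Submodule.span ℂ {f | ∃ k, chiK μ k = χ ∧ f = coordMonomial v k} :=
  hvw.mem_span_coordMonomial hμ ((contDiff_invCharFun Γ).mul h.moments.contDiff_fourier)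
    (h.linearFieldD_invCharFun_mul hL hΓ)

lemma integral_mul_partialD {f g : Space n → ℂ} (hf : Differentiable ℝ f)
    (hg : Differentiable ℝ g) (i : Fin n) (hf'g : Integrable fun s => partialD i f s * g s)
    (hfg' : Integrable fun s => f s * partialD i g s) (hfg : Integrable fun s => f s * g s) :
    ∫ s, f s * partialD i g s = -∫ s, partialD i f s * g s :=
  integral_mul_fderiv_eq_neg_fderiv_mul_of_integrable hf'g hfg' hfg (fun x _ => hf x)
    fun x _ => hg x

lemma integral_mul_partialD_of_compactSupport {f g : Space n → ℂ} (hf : ContDiff ℝ 1 f)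
    (hg : ContDiff ℝ 1 g) (hgc : HasCompactSupport g) (i : Fin n) :
    ∫ s, f s * partialD i g s = -∫ s, partialD i f s * g s := by
  have hf' : Continuous (partialD i f) :=
    (ContDiff.partialD (m := 0) hf (by norm_num) i).continuous
  have hg' : Continuous (partialD i g) :=
    (ContDiff.partialD (m := 0) hg (by norm_num) i).continuous
  refine integral_mul_partialD (hf.differentiable one_ne_zero) (hg.differentiable one_ne_zero) i
    ?_ ?_ ?_
  · exact (hf'.mul hg.continuous).integrable_of_hasCompactSupport hgc.mul_left
  · exact (hf.continuous.mul hg').integrable_of_hasCompactSupport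
      ((hgc.fderiv_apply (𝕜 := ℝ) _).mul_left)
  · exact (hf.continuous.mul hg.continuous).integrable_of_hasCompactSupport hgc.mul_left

/-- Classical eigenfunctions are weak solutions. -/
lemma isWeakSolution_of_classical {B H : Matrix (Fin n) (Fin n) ℝ} (hB : Bᵀ = B) {χ : ℂ}
    {φ : Space n → ℂ} (hφ : ContDiff ℝ 2 φ) (hm : HasAllMoments φ)
    (he : ∀ s, fokkerPlanck B H φ s = χ * φ s) : IsWeakSolution B H χ φ := by
  refine ⟨hm, fun ψ hψ hψc => ?_⟩
  have hφ1 : ContDiff ℝ 1 φ := hφ.of_le one_le_two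
  have hψ1 : ContDiff ℝ 1 ψ := hψ.of_le (one_le_two.trans two_le_smooth)
  have hpφ : ∀ j, ContDiff ℝ 1 (partialD j φ) := fun j => ContDiff.partialD hφ (by norm_num) j
  have hpψ : ∀ j, ContDiff ℝ 1 (partialD j ψ) := fun j =>
    (ContDiff.partialD (m := ∞) hψ (by simp) j).of_le (one_le_two.trans two_le_smooth)
  have hcψ : ∀ j, HasCompactSupport (partialD j ψ) := fun j => hψc.fderiv_apply (𝕜 := ℝ) _
  set F : Fin n → Space n → ℂ := fun i t => ∑ j, (B i j : ℂ) * partialD j φ t with hF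
  set G : Fin n → Space n → ℂ := fun i t => (∑ j, (H i j : ℂ) * (t j : ℂ)) * φ t with hG
  have hFs : ∀ i, ContDiff ℝ 1 (F i) := fun i =>
    ContDiff.sum fun j _ => contDiff_const.mul (hpφ j)
  have hGs : ∀ i, ContDiff ℝ 1 (G i) := fun i =>
    (ContDiff.sum fun j _ => contDiff_const.mul (contDiff_coord j)).mul hφ1
  have hint : ∀ {f g : Space n → ℂ}, Continuous f → Continuous g → HasCompactSupport g →
      Integrable fun s => f s * g s := fun hf hg hgc =>
    (hf.mul hg).integrable_of_hasCompactSupport hgc.mul_left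
  have hpc : ∀ {f : Space n → ℂ} i, ContDiff ℝ 1 f → Continuous (partialD i f) := fun i hf =>
    (ContDiff.partialD (m := 0) hf (by norm_num) i).continuous
  have hpp : ∀ i j, HasCompactSupport (partialD i (partialD j ψ)) := fun i j =>
    (hcψ j).fderiv_apply (𝕜 := ℝ) _
  -- The diffusion term takes two integrations by parts and the drift term one; the compact support
  -- of `ψ` gives all the integrability needed.
  have hdivF : ∀ i, ∫ s, partialD i (F i) s * ψ s =
      ∑ j, (B i j : ℂ) * ∫ s, φ s * partialD j (partialD i ψ) s := by
    intro i
    have a1 := integral_mul_partialD_of_compactSupport (hFs i) hψ1 hψc i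
    have a2 : ∫ s, F i s * partialD i ψ s =
        ∑ j, (B i j : ℂ) * ∫ s, partialD j φ s * partialD i ψ s := by
      simp only [hF, Finset.sum_mul, mul_assoc]
      rw [integral_finsetSum _ fun j _ =>
        (hint (hpφ j).continuous (hpψ i).continuous (hcψ i)).const_mul _]
      exact Finset.sum_congr rfl fun j _ => integral_const_mul _ _
    have a3 : ∀ j, ∫ s, φ s * partialD j (partialD i ψ) s =
        -∫ s, partialD j φ s * partialD i ψ s := fun j =>
      integral_mul_partialD_of_compactSupport hφ1 (hpψ i) (hcψ i) j
    rw [← neg_eq_iff_eq_neg] at a1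
    rw [← a1, a2, ← Finset.sum_neg_distrib]
    exact Finset.sum_congr rfl fun j _ => by rw [a3]; ring
  have hdivG : ∀ i, ∫ s, partialD i (G i) s * ψ s = -∫ s, G i s * partialD i ψ s := fun i => by
    rw [integral_mul_partialD_of_compactSupport (hGs i) hψ1 hψc i, neg_neg]
  have lhs : ∫ s, φ s * fokkerPlanckAdjoint B H ψ s =
      (1 / 2 : ℂ) * ∑ i, ∑ j, (B i j : ℂ) * (∫ s, φ s * partialD i (partialD j ψ) s) +
        ∑ i, ∫ s, G i s * partialD i ψ s := by
    have e : ∀ s, φ s * fokkerPlanckAdjoint B H ψ s =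
        (1 / 2 : ℂ) * ∑ i, ∑ j, (B i j : ℂ) * (φ s * partialD i (partialD j ψ) s) +
          ∑ i, G i s * partialD i ψ s := by
      intro s
      rw [fokkerPlanckAdjoint_eq B H (hψ.of_le two_le_smooth), mul_add]
      congr 1
      · simp only [Finset.mul_sum]
        exact Finset.sum_congr rfl fun i _ => Finset.sum_congr rfl fun j _ => by ring
      · simp only [hG, Finset.mul_sum, Finset.sum_mul]
        exact Finset.sum_congr rfl fun i _ => Finset.sum_congr rfl fun j _ => by ring
    have i1 : ∀ i j, Integrable fun s => (B i j : ℂ) * (φ s * partialD i (partialD j ψ) s) :=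
      fun i j => (hint hφ1.continuous (hpc i (hpψ j)) (hpp i j)).const_mul _
    have i2 : ∀ i, Integrable fun s => G i s * partialD i ψ s := fun i =>
      hint (hGs i).continuous (hpψ i).continuous (hcψ i)
    simp only [e]
    rw [integral_add ((integrable_finsetSum _ fun i _ => integrable_finsetSum _ fun j _ =>
      i1 i j).const_mul _) (integrable_finsetSum _ fun i _ => i2 i), integral_const_mul,
      integral_finsetSum _ fun i _ => i2 i,
      integral_finsetSum _ fun i _ => integrable_finsetSum _ fun j _ => i1 i j]
    congr 2
    refine Finset.sum_congr rfl fun i _ => ?_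
    rw [integral_finsetSum _ fun j _ => i1 i j]
    exact Finset.sum_congr rfl fun j _ => integral_const_mul _ _
  have rhs : χ * ∫ s, φ s * ψ s =
      (1 / 2 : ℂ) * ∑ i, (∫ s, partialD i (F i) s * ψ s) - ∑ i, ∫ s, partialD i (G i) s * ψ s := by
    rw [← integral_const_mul]
    have e : ∀ s, χ * (φ s * ψ s) = (1 / 2 : ℂ) * ∑ i, partialD i (F i) s * ψ s -
        ∑ i, partialD i (G i) s * ψ s := by
      intro s
      rw [← mul_assoc, ← he s, fokkerPlanck, sub_mul, mul_assoc, divergence, divergence,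
        Finset.sum_mul, Finset.sum_mul]
    have i1 : ∀ i, Integrable fun s => partialD i (F i) s * ψ s := fun i =>
      hint (hpc i (hFs i)) hψ1.continuous hψc
    have i2 : ∀ i, Integrable fun s => partialD i (G i) s * ψ s := fun i =>
      hint (hpc i (hGs i)) hψ1.continuous hψc
    simp only [e]
    rw [integral_sub ((integrable_finsetSum _ fun i _ => i1 i).const_mul _)
      (integrable_finsetSum _ fun i _ => i2 i), integral_const_mul,
      integral_finsetSum _ fun i _ => i1 i, integral_finsetSum _ fun i _ => i2 i]
  rw [lhs, rhs]
  simp only [hdivF, hdivG, Finset.sum_neg_distrib, sub_neg_eq_add]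
  congr 2
  -- The integrations by parts exchanged the two derivative indices; the symmetry of `B` restores
  -- them.
  rw [Finset.sum_comm]
  refine Finset.sum_congr rfl fun i _ => Finset.sum_congr rfl fun j _ => ?_
  rw [show B j i = B i j from congrFun (congrFun hB i) j]

/-- Differentiation becomes multiplication under the Fourier transform. -/
lemma fourier_dirD {f : Space n → ℂ} (hf : ContDiff ℝ ∞ f) (hi : Integrable f)
    (hi' : ∀ i, Integrable (partialD i f)) (v : Fin n → ℂ) (ξ : Space n) :
    𝓕 (dirD v f) ξ = twoPiI * coordAlong v ξ * 𝓕 f ξ := by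
  have hw := contDiff_planeWave ξ
  have hint : ∀ {g : Space n → ℂ}, Integrable g → Integrable fun s => planeWave ξ s * g s :=
    fun {g} hg => hg.norm.mono' (hw.continuous.aestronglyMeasurable.mul hg.aestronglyMeasurable)
      (Filter.Eventually.of_forall fun s => by rw [norm_mul, norm_planeWave, one_mul])
  have h1 : ∀ i, ∫ s, planeWave ξ s * partialD i f s = twoPiI * (ξ i : ℂ) * 𝓕 f ξ := by
    intro i
    have e : ∀ s, partialD i (planeWave ξ) s * f s =
        (-twoPiI * (ξ i : ℂ)) * (planeWave ξ s * f s) := fun s => by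
      rw [partialD_planeWave]; ring
    rw [integral_mul_partialD (hw.differentiable (by simp)) (hf.differentiable (by simp)) i
      (by simp only [e]; exact (hint hi).const_mul _) (hint (hi' i)) (hint hi)]
    simp only [e]
    rw [integral_const_mul, fourier_eq_integral_planeWave]
    simp only [mul_comm (planeWave ξ _)]
    ring
  rw [fourier_eq_integral_planeWave]
  have e : ∀ s, dirD v f s * planeWave ξ s = ∑ i, v i * (planeWave ξ s * partialD i f s) :=
    fun s => by
      rw [dirD, Finset.sum_mul]
      exact Finset.sum_congr rfl fun i _ => by ring
  simp only [e]
  rw [integral_finsetSum _ fun i _ => (hint (hi' i)).const_mul _]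
  simp only [integral_const_mul, h1, coordAlong, Finset.mul_sum, Finset.sum_mul]
  exact Finset.sum_congr rfl fun i _ => by ring

/-- The Fourier transform of `Φ_k`. -/
lemma fourier_PhiK {Γ : Matrix (Fin n) (Fin n) ℝ} {yp ym : Fin n → Idx n → ℂ}
    (hq : ∀ k, qPart (ym k) = 0) (hr : ∀ k u, ym k (Sum.inr u) = 0) (hΓ : Γ.PosDef)
    (hS : matSigma yp = complexify Γ⁻¹) (k : Fin n → ℕ) (ξ : Space n) :
    𝓕 (PhiK yp ym k) ξ =
      twoPiI ^ (∑ j, k j) * coordMonomial (fun j => pPart (ym j)) k ξ * 𝓕 (Phi0 yp) ξ := by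
  have hΓs : Γᵀ = Γ := by simpa [Matrix.IsHermitian] using hΓ.isHermitian
  have hSs : (Γ⁻¹)ᵀ = Γ⁻¹ := by rw [Matrix.transpose_nonsing_inv, hΓs]
  have h0 : Phi0 yp = polyGaussian Γ⁻¹ 1 := by
    ext s; simp [Phi0, gaussian, polyGaussian, hS]
  refine (PhiK_induction (yp := yp) (ym := ym)
    (C := fun k f => (∃ p, f = polyGaussian Γ⁻¹ p) ∧ ∀ ξ, 𝓕 f ξ =
      twoPiI ^ (∑ j, k j) * coordMonomial (fun j => pPart (ym j)) k ξ * 𝓕 (Phi0 yp) ξ)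
    ?_ ?_ k).2 ξ
  · exact ⟨⟨1, h0⟩, fun ξ => by simp [coordMonomial]⟩
  · rintro k f j ⟨⟨p, rfl⟩, he⟩
    rw [ladderOp_eq_dirD (hq j) (hr j)]
    refine ⟨exists_dirD_polyGaussian hSs _ p, fun ξ => ?_⟩
    rw [fourier_dirD (contDiff_polyGaussian _ p)
      (hasAllMoments_polyGaussian hΓ.inv p).integrable fun i => by
        obtain ⟨q, hq⟩ := exists_partialD_polyGaussian hSs i p
        rw [hq]
        exact (hasAllMoments_polyGaussian hΓ.inv q).integrable]
    have e1 := congrFun (coordAlong_mul_coordMonomial (fun j => pPart (ym j)) k j) ξ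
    rw [Pi.mul_apply] at e1
    have e2 : ∑ i, (k + Pi.single j 1 : Fin n → ℕ) i = (∑ i, k i) + 1 := by
      simp [Finset.sum_add_distrib]
    rw [he, ← e1, e2, pow_succ]
    ring

end Adjoint

/-! ### Classification of weak solutions by comparing Fourier transforms. -/

section Classification

open FourierTransform

variable {n : ℕ}

lemma HasAllMoments.smul {f : Space n → ℂ} (hf : HasAllMoments f) (c : ℂ) :
    HasAllMoments (c • f) := fun m => by
  refine ((hf m).const_mul c).congr (Filter.Eventually.of_forall fun s => ?_)
  simp only [Pi.smul_apply, smul_eq_mul]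
  ring

lemma HasAllMoments.add {f g : Space n → ℂ} (hf : HasAllMoments f) (hg : HasAllMoments g) :
    HasAllMoments (f + g) := fun m => by
  refine ((hf m).add (hg m)).congr (Filter.Eventually.of_forall fun s => ?_)
  simp only [Pi.add_apply]
  ring

lemma hasAllMoments_zero : HasAllMoments (0 : Space n → ℂ) := fun m => by simp

lemma fourier_add_of_integrable {f g : Space n → ℂ} (hf : Integrable f) (hg : Integrable g)
    (ξ : Space n) : 𝓕 (f + g) ξ = 𝓕 f ξ + 𝓕 g ξ := by
  have hint : ∀ {u : Space n → ℂ}, Integrable u → Integrable fun s => u s * planeWave ξ s :=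
    fun {u} hu => hu.norm.mono'
      (hu.aestronglyMeasurable.mul (contDiff_planeWave ξ).continuous.aestronglyMeasurable)
      (Filter.Eventually.of_forall fun s => by rw [norm_mul, norm_planeWave, mul_one])
  simp only [fourier_eq_integral_planeWave, Pi.add_apply, add_mul]
  exact integral_add (hint hf) (hint hg)

lemma fourier_smul_complex (c : ℂ) (f : Space n → ℂ) (ξ : Space n) :
    𝓕 (c • f) ξ = c * 𝓕 f ξ := by
  simp only [fourier_eq_integral_planeWave, Pi.smul_apply, smul_eq_mul, mul_assoc]
  exact integral_const_mul _ _

lemma hasAllMoments_PhiK {H B Γ : Matrix (Fin n) (Fin n) ℝ} {μ : Fin n → ℂ}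
    {yp ym : Fin n → Idx n → ℂ} (hq : ∀ k, qPart (ym k) = 0) (hr : ∀ k u, ym k (Sum.inr u) = 0)
    (hv : ∀ k, complexify H *ᵥ pPart (ym k) = (-μ k) • pPart (ym k))
    (hL : H * Γ + Γ * Hᵀ = -B) (hΓ : Γ.PosDef) (hS : matSigma yp = complexify Γ⁻¹)
    (k : Fin n → ℕ) : HasAllMoments (PhiK yp ym k) := by
  obtain ⟨p, hp⟩ := (PhiK_properties hq hr hv hL hΓ hS k).2.1
  rw [hp]
  exact hasAllMoments_polyGaussian hΓ.inv p

/-- The Fourier transform of `Φ₀` is a non-zero multiple of a Gaussian. -/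
lemma exists_fourier_Phi0 {H B Γ : Matrix (Fin n) (Fin n) ℝ} {μ : Fin n → ℂ}
    (hHB : BasicConditions H B μ) {yp ym : Fin n → Idx n → ℂ} {w : Fin n → Fin n → ℂ}
    (hq : ∀ k, qPart (ym k) = 0) (hr : ∀ k u, ym k (Sum.inr u) = 0)
    (hw : DualEigenbasis H μ (fun k => pPart (ym k)) w) (hL : H * Γ + Γ * Hᵀ = -B)
    (hΓ : Γ.PosDef) (hS : matSigma yp = complexify Γ⁻¹) :
    ∃ c : ℂ, c ≠ 0 ∧ ∀ ξ, invCharFun Γ ξ * 𝓕 (Phi0 yp) ξ = c := by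
  have hμ := hHB.re_pos
  have hB : Bᵀ = B := by simpa [Matrix.IsHermitian] using hHB.posSemidef.isHermitian
  have hΓs : Γᵀ = Γ := by simpa [Matrix.IsHermitian] using hΓ.isHermitian
  have hprop := PhiK_properties hq hr hw.eigen_v hL hΓ hS
  have hmom := hasAllMoments_PhiK hq hr hw.eigen_v hL hΓ hS
  have hzero : PhiK yp ym 0 = Phi0 yp := by
    have h1 : ∀ l : List (Fin n),
        l.foldr (fun j f => (ladderOp (ym j))^[(0 : Fin n → ℕ) j] f) (Phi0 yp) = Phi0 yp := by
      intro l
      induction l with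
      | nil => rfl
      | cons j l => simp
    exact h1 _
  have hweak0 : IsWeakSolution B H 0 (Phi0 yp) := by
    rw [← hzero]
    refine isWeakSolution_of_classical hB ((hprop 0).1.of_le two_le_smooth) (hmom 0) fun s => ?_
    rw [(hprop 0).2.2 s]
    simp [chiK]
  -- No Gaussian integral is computed: `Φ₀` is a weak solution for `χ = 0`, so the product is
  -- constant along with every smooth solution of the homogeneous equation. Injectivity of the
  -- Fourier transform excludes the constant `0`.
  have hconst : ∀ ξ, invCharFun Γ ξ * 𝓕 (Phi0 yp) ξ =
      invCharFun Γ 0 * 𝓕 (Phi0 yp) 0 :=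
    hw.eq_const_of_zero hμ (((contDiff_invCharFun Γ).mul hweak0.moments.contDiff_fourier).of_le
      (one_le_two.trans two_le_smooth)) fun ξ => by
        rw [hweak0.linearFieldD_invCharFun_mul hL hΓs, zero_mul]
  refine ⟨_, ?_, hconst⟩
  intro h0
  have h1 := ae_eq_zero_of_fourier_eq_zero hweak0.moments.integrable fun ξ =>
    (mul_eq_zero.1 ((hconst ξ).trans h0)).resolve_left (invCharFun_ne_zero Γ ξ)
  obtain ⟨s, hs⟩ := h1.exists
  exact Complex.exp_ne_zero _ hs

/-- Weak solutions with moments of all orders are combinations of the `Φ_k`. -/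
theorem exists_mem_span_ae_eq {H B Γ : Matrix (Fin n) (Fin n) ℝ} {μ : Fin n → ℂ}
    (hHB : BasicConditions H B μ) {yp ym : Fin n → Idx n → ℂ} {w : Fin n → Fin n → ℂ}
    (hq : ∀ k, qPart (ym k) = 0) (hr : ∀ k u, ym k (Sum.inr u) = 0)
    (hw : DualEigenbasis H μ (fun k => pPart (ym k)) w) (hL : H * Γ + Γ * Hᵀ = -B)
    (hΓ : Γ.PosDef) (hS : matSigma yp = complexify Γ⁻¹) {χ : ℂ} {φ : Space n → ℂ}
    (h : IsWeakSolution B H χ φ) :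
    ∃ g ∈ Submodule.span ℂ {f | ∃ k : Fin n → ℕ, chiK μ k = χ ∧ f = PhiK yp ym k},
      φ =ᵐ[volume] g := by
  have hμ := hHB.re_pos
  have hΓs : Γᵀ = Γ := by simpa [Matrix.IsHermitian] using hΓ.isHermitian
  have hmom := hasAllMoments_PhiK hq hr hw.eigen_v hL hΓ hS
  obtain ⟨c, hc0, hconst⟩ := exists_fourier_Phi0 hHB hq hr hw hL hΓ hS
  have hspan := h.mem_span hw hμ hL hΓs
  -- Every combination of admissible monomials is the normalised transform of a combination of the
  -- `Φ_k`. The moments are carried through the induction because additivity of the transform needs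
  -- integrability.
  have hex : ∀ u ∈ Submodule.span ℂ {f | ∃ k, chiK μ k = χ ∧
      f = coordMonomial (fun k => pPart (ym k)) k}, ∃ g ∈ Submodule.span ℂ
        {f | ∃ k : Fin n → ℕ, chiK μ k = χ ∧ f = PhiK yp ym k},
      HasAllMoments g ∧ ∀ ξ, invCharFun Γ ξ * 𝓕 g ξ = u ξ := by
    intro u hu
    induction hu using Submodule.span_induction with
    | mem f hf =>
      obtain ⟨k, hk, rfl⟩ := hf
      have hne : twoPiI ^ (∑ j, k j) * c ≠ 0 := mul_ne_zero (pow_ne_zero _ twoPiI_ne_zero) hc0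
      refine ⟨(twoPiI ^ (∑ j, k j) * c)⁻¹ • PhiK yp ym k,
        Submodule.smul_mem _ _ (Submodule.subset_span ⟨k, hk, rfl⟩), (hmom k).smul _, fun ξ => ?_⟩
      rw [fourier_smul_complex, fourier_PhiK hq hr hΓ hS]
      calc _ = (twoPiI ^ (∑ j, k j) * c)⁻¹ * (twoPiI ^ (∑ j, k j) *
            (invCharFun Γ ξ * 𝓕 (Phi0 yp) ξ)) * coordMonomial (fun j => pPart (ym j)) k ξ := by ring
        _ = _ := by rw [hconst, inv_mul_cancel₀ hne, one_mul]
    | zero =>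
      refine ⟨0, Submodule.zero_mem _, hasAllMoments_zero, fun ξ => ?_⟩
      simp [fourier_eq_integral_planeWave]
    | add f g _ _ hf hg =>
      obtain ⟨f', hf1, hf2, hf3⟩ := hf
      obtain ⟨g', hg1, hg2, hg3⟩ := hg
      refine ⟨f' + g', Submodule.add_mem _ hf1 hg1, hf2.add hg2, fun ξ => ?_⟩
      rw [fourier_add_of_integrable hf2.integrable hg2.integrable, mul_add, hf3, hg3, Pi.add_apply]
    | smul a f _ hf =>
      obtain ⟨f', hf1, hf2, hf3⟩ := hf
      refine ⟨a • f', Submodule.smul_mem _ _ hf1, hf2.smul a, fun ξ => ?_⟩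
      rw [fourier_smul_complex, mul_left_comm, hf3, Pi.smul_apply, smul_eq_mul]
  obtain ⟨g, hg1, hg2, hg3⟩ := hex _ hspan
  refine ⟨g, hg1, ?_⟩
  have hneg : HasAllMoments ((-1 : ℂ) • g) := hg2.smul _
  have h1 := ae_eq_zero_of_fourier_eq_zero (h.moments.integrable.add hneg.integrable) fun ξ => by
    rw [fourier_add_of_integrable h.moments.integrable hneg.integrable, fourier_smul_complex]
    have := mul_left_cancel₀ (invCharFun_ne_zero Γ ξ) (hg3 ξ)
    rw [this]
    ring
  filter_upwards [h1] with s hs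
  simp only [Pi.add_apply, Pi.smul_apply, smul_eq_mul, Pi.zero_apply] at hs
  linear_combination hs

/-- The functions `Φ_k` do not vanish identically. -/
lemma PhiK_ne_zero {H Γ : Matrix (Fin n) (Fin n) ℝ} {μ : Fin n → ℂ}
    {yp ym : Fin n → Idx n → ℂ} {w : Fin n → Fin n → ℂ}
    (hq : ∀ k, qPart (ym k) = 0) (hr : ∀ k u, ym k (Sum.inr u) = 0)
    (hw : DualEigenbasis H μ (fun k => pPart (ym k)) w)
    (hΓ : Γ.PosDef) (hS : matSigma yp = complexify Γ⁻¹)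
    (h0 : ∀ ξ, 𝓕 (Phi0 yp) ξ ≠ 0) (k : Fin n → ℕ) : PhiK yp ym k ≠ 0 := by
  intro hz
  apply hw.coordMonomial_ne_zero k
  ext ξ
  have h1 := fourier_PhiK hq hr hΓ hS k ξ
  rw [hz, fourier_eq_integral_planeWave] at h1
  simp only [Pi.zero_apply, zero_mul, integral_zero] at h1
  have h2 := (mul_eq_zero.1 h1.symm).resolve_right (h0 ξ)
  exact (mul_eq_zero.1 h2).resolve_left (pow_ne_zero _ twoPiI_ne_zero)

end Classification

end

end OrnsteinUhlenbeck

/-! ### The main theorem. -/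

theorem theorem3p2 {n : ℕ} (H B : Matrix (Fin n) (Fin n) ℝ) (μ : Fin n → ℂ)
    (hHB : BasicConditions H B μ)
    (yp ym : Fin n → Idx n → ℂ)
    (hyp : ∀ k, IsLadderVector B H (μ k) (yp k))
    (hym : ∀ k, IsLadderVector B H (-μ k) (ym k)) :
    -- the matrix `Σ = Q P⁻¹` in the definition of `Φ₀` makes sense
    IsUnit (matP yp).det ∧
    -- the eigenvalues are exactly the numbers `χ_k`
    (∀ χ : ℂ, IsEigenvalue B H χ ↔ ∃ k : Fin n → ℕ, χ = chiK μ k) ∧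
    -- `Φ_k` is an eigenfunction with eigenvalue `χ_k`
    (∀ k : Fin n → ℕ, IsEigenfunction B H (chiK μ k) (PhiK yp ym k)) ∧
    -- every eigenfunction is a combination of the `Φ_k` that have its eigenvalue
    (∀ (χ : ℂ) (φ : Space n → ℂ), IsEigenfunction B H χ φ →
      φ ∈ Submodule.span ℂ {f | ∃ k : Fin n → ℕ, chiK μ k = χ ∧ f = PhiK yp ym k}) ∧
    -- and no further eigenfunctions arise when no regularity is required of them
    (∀ (χ : ℂ) (φ : Space n → ℂ), IsWeakSolution B H χ φ →
      ∃ g ∈ Submodule.span ℂ {f | ∃ k : Fin n → ℕ, chiK μ k = χ ∧ f = PhiK yp ym k},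
        φ =ᵐ[volume] g) := by
  obtain ⟨hq, hr, hP, w, Γ, hw, hL, hΓ, hS⟩ := hHB.ladder_structure hyp hym
  have hB : Bᵀ = B := by simpa [Matrix.IsHermitian] using hHB.posSemidef.isHermitian
  have hprop := PhiK_properties hq hr hw.eigen_v hL hΓ hS
  obtain ⟨c, hc0, hc⟩ := exists_fourier_Phi0 hHB hq hr hw hL hΓ hS
  have hweak : ∀ (χ : ℂ) (φ : Space n → ℂ), IsWeakSolution B H χ φ →
      ∃ g ∈ Submodule.span ℂ {f | ∃ k : Fin n → ℕ, chiK μ k = χ ∧ f = PhiK yp ym k},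
        φ =ᵐ[volume] g := fun χ φ h => exists_mem_span_ae_eq hHB hq hr hw hL hΓ hS h
  have heig : ∀ k : Fin n → ℕ, IsEigenfunction B H (chiK μ k) (PhiK yp ym k) := fun k =>
    { contDiff := (hprop k).1.of_le two_le_smooth
      moments := hasAllMoments_PhiK hq hr hw.eigen_v hL hΓ hS k
      ne_zero := PhiK_ne_zero hq hr hw hΓ hS
        (fun ξ h0 => hc0 (by rw [← hc ξ, h0, mul_zero])) k
      eigen := (hprop k).2.2 }
  have hcomplete : ∀ (χ : ℂ) (φ : Space n → ℂ), IsEigenfunction B H χ φ →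
      φ ∈ Submodule.span ℂ {f | ∃ k : Fin n → ℕ, chiK μ k = χ ∧ f = PhiK yp ym k} := by
    intro χ φ hφ
    obtain ⟨g, hg, hφg⟩ := hweak χ φ
      (isWeakSolution_of_classical hB hφ.contDiff hφ.moments hφ.eigen)
    -- Both functions are continuous, so almost everywhere equality becomes equality.
    have hgc : Continuous g := by
      clear hφg
      induction hg using Submodule.span_induction with
      | mem f hf =>
        obtain ⟨k, -, rfl⟩ := hf
        exact (hprop k).1.continuous
      | zero => exact continuous_zero
      | add f g _ _ hf hg => exact hf.add hg
      | smul a f _ hf => exact hf.const_smul a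
    rwa [hφ.contDiff.continuous.ae_eq_iff_eq volume hgc |>.1 hφg]
  refine ⟨hP, fun χ => ⟨?_, ?_⟩, heig, hcomplete, hweak⟩
  · rintro ⟨φ, hφ⟩
    by_contra! hne
    -- If `χ` is none of the `χ_k`, completeness puts the eigenfunction in the span of the empty
    -- set.
    have hempty : {f | ∃ k : Fin n → ℕ, chiK μ k = χ ∧ f = PhiK yp ym k} = ∅ :=
      Set.eq_empty_iff_forall_notMem.2 fun f ⟨k, hk, _⟩ => hne k hk.symm
    have hmem := hcomplete χ φ hφ
    rw [hempty, Submodule.span_empty, Submodule.mem_bot] at hmem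
    exact hφ.ne_zero hmem
  · rintro ⟨k, rfl⟩
    exact ⟨_, heig k⟩
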